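/- Let $R$ be a commutative noetherian local ring with residue field $k$, and let $\operatorname{mod} R$ be the category of finitely generated $R$-modules; subcategories of $\operatorname{mod} R$ are full and closed under isomorphism. For a subcategory $\mathsf S$ let $\langle \mathsf S\rangle$ be the smallest subcategory of $\operatorname{mod} R$ that contains $\mathsf S\cup\{0\}$ and is closed under extensions and direct summands, and let $\operatorname{cosyz}\mathsf S$ consist of all modules $X$ for which there is an exact sequence $0\to N\to P\to X\to 0$ with $N$ in $\mathsf S$ and $P$ finitely generated and projective. Define the tiers of $\mathsf S$ by $$\mathfrak T_{-1}(\mathsf S)=\langle\mathsf S\rangle,\qquad \mathfrak T_0(\mathsf S)=\langle \mathsf S\cup\operatorname{cosyz}\langle\mathsf S\rangle\rangle,\qquad \mathfrak T_n(\mathsf S)=\langle \mathfrak T_{n-1}(\mathsf S)\cup\operatorname{cosyz}\mathfrak T_{n-1}(\mathsf S)\rangle\quad (n\ge 1).$$ Let $\mathsf S(R)$ be the subcategory of all modules isomorphic to $R/\mathfrak p$ for some prime ideal $\mathfrak p$ such that $R_{\mathfrak p}$ is not regular. A finitely generated $R$-module $M$ is maximal Cohen--Macaulay if $\operatorname{depth}_R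 M=\dim R$ (the zero module has infinite depth), and $R$ is Cohen--Macaulay if it is a maximal Cohen--Macaulay module over itself. The ring $R$ has an isolated singularity if $R$ is not regular but $R_{\mathfrak p}$ is regular for every non-maximal prime ideal $\mathfrak p$. Write $\mathrm{CM}(R)$ for the subcategory of maximal Cohen--Macaulay modules and set $$\varepsilon(R)=\min\{\,n\ge -1 : \mathrm{CM}(R)\subseteq\mathfrak T_n(\mathsf S(R))\,\}.$$ Suppose that $R$ is Cohen--Macaulay of dimension $d$. (a) If $d\ge 1$, then every maximal Cohen--Macaulay module in $\mathfrak T_{d-2}(\{k\})$ is free. (b) If $R$ has an isolated singularity, then $\varepsilon(R)=d-1$; in particular, the minimum exists. -/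

import Mathlib

open CategoryTheory IsLocalRing

universe u v

namespace ModTier

section Depth

variable (R : Type u) [CommRing R] [IsLocalRing R] (M : Type v) [AddCommGroup M] [Module R M]

/-- The depth of a finitely generated module `M` over a local ring: the supremum of the lengths of
the `M`-regular sequences in the maximal ideal. For `M ≠ 0` finitely generated the condition
`(x₁, …, xₙ) M ≠ M` is automatic by Nakayama's lemma, so it is not required; the zero module then
gets depth `⊤`, which is the usual convention. -/
noncomputable def depth : ℕ∞ :=
  ⨆ (rs : List R) (_ : ∀ r ∈ rs, r ∈ maximalIdeal R)
    (_ : RingTheory.Sequence.IsWeaklyRegular M rs), (rs.length : ℕ∞)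

/-- A finitely generated module `M` is maximal Cohen–Macaulay if `depth M = dim R`. -/
def IsMaximalCohenMacaulay : Prop :=
  Module.Finite R M ∧ ((depth R M : ℕ∞) : WithBot ℕ∞) = ringKrullDim R

end Depth

section LocalRings

variable (R : Type u) [CommRing R]

/-- A noetherian local ring is Cohen–Macaulay if it is a maximal Cohen–Macaulay module over
itself. -/
def IsCohenMacaulayLocalRing [IsLocalRing R] : Prop :=
  IsNoetherianRing R ∧ IsMaximalCohenMacaulay R R

/-- The singular locus: the primes `p` such that `R_p` is not a regular local ring. -/
def singularLocus : Set (PrimeSpectrum R) :=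
  {p | ¬ IsRegularLocalRing (Localization.AtPrime p.asIdeal)}

/-- A local ring has an isolated singularity if it is singular, but its localization at every
non-maximal prime ideal is regular. -/
def HasIsolatedSingularity [IsLocalRing R] : Prop :=
  ¬ IsRegularLocalRing R ∧
    ∀ p : PrimeSpectrum R, p.asIdeal ≠ maximalIdeal R →
      IsRegularLocalRing (Localization.AtPrime p.asIdeal)

end LocalRings

section Tiers

variable {R : Type u} [CommRing R]

/-- The smallest subcategory of `mod R` that contains `S` and the zero modules and is closed under
extensions and direct summands. -/
inductive Closure (S : ObjectProperty (FGModuleCat.{u} R)) : FGModuleCat.{u} R → Prop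
  | of {X : FGModuleCat.{u} R} (hX : S X) : Closure S X
  | zero {X : FGModuleCat.{u} R} (hX : Subsingleton X) : Closure S X
  | extension {X Y Z : FGModuleCat.{u} R} (f : X →ₗ[R] Y) (g : Y →ₗ[R] Z)
      (hf : Function.Injective f) (hfg : Function.Exact f g) (hg : Function.Surjective g)
      (hX : Closure S X) (hZ : Closure S Z) : Closure S Y
  | summand {X X' Y : FGModuleCat.{u} R} (e : Y ≃ₗ[R] X × X') (hY : Closure S Y) : Closure S X

/-- The cosyzygies of `S`: the modules `X` with an exact sequence `0 → N → P → X → 0` where `N` is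
in `S` and `P` is finitely generated and projective. -/
def Cosyzygy (S : ObjectProperty (FGModuleCat.{u} R)) : ObjectProperty (FGModuleCat.{u} R) :=
  fun X => ∃ (N P : FGModuleCat.{u} R) (f : N →ₗ[R] P) (g : P →ₗ[R] X),
    S N ∧ Module.Projective R P ∧
      Function.Injective f ∧ Function.Exact f g ∧ Function.Surjective g

/-- The tiers `𝔗_n(S)` with `n ≥ 0`. -/
def tierNat (S : ObjectProperty (FGModuleCat.{u} R)) : ℕ → ObjectProperty (FGModuleCat.{u} R)
  | 0 => Closure (S ⊔ Cosyzygy (Closure S))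
  | n + 1 => Closure (tierNat S n ⊔ Cosyzygy (tierNat S n))

/-- The tiers `𝔗_n(S)` with `n ≥ -1`, where `𝔗_{-1}(S)` is the closure of `S`. Indices below `-1`
carry no meaning (they are given the value at `-1`) and are never used. -/
def tier (S : ObjectProperty (FGModuleCat.{u} R)) : ℤ → ObjectProperty (FGModuleCat.{u} R)
  | Int.ofNat n => tierNat S n
  | Int.negSucc _ => Closure S

variable (R)

/-- The subcategory `{k}`: the modules isomorphic to the residue field of `R`. -/
def residueFieldSubcat [IsLocalRing R] : ObjectProperty (FGModuleCat.{u} R) :=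
  fun X => Nonempty (X ≃ₗ[R] ResidueField R)

/-- The subcategory `S(R)`: the modules isomorphic to `R/p` for some `p` in the singular locus. -/
def singularSubcat : ObjectProperty (FGModuleCat.{u} R) :=
  fun X => ∃ p ∈ singularLocus R, Nonempty (X ≃ₗ[R] R ⧸ p.asIdeal)

/-- The subcategory of maximal Cohen–Macaulay modules. -/
def maximalCohenMacaulay [IsLocalRing R] : ObjectProperty (FGModuleCat.{u} R) :=
  fun X => IsMaximalCohenMacaulay R X

end Tiers

end ModTier

/-! The argument has two opposite halves. Throughout, depth is measured by vanishing of `Ext(k, -)`,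
which Rees' theorem identifies with the existence of regular sequences.

Bounding the tiers. For a finitely generated X let Γ(X) be its submodule of elements killed by a
power of the maximal ideal. Consider the X for which X/Γ(X) has projective dimension < n, where n <
d. Then X/Γ(X) has depth at least d + 1 - n ≥ 2, so H¹ of X with support in the maximal ideal
vanishes, and dividing out Γ preserves exactness of short exact sequences starting in X. Hence this
class is closed under extensions and summands (`HasTorsionFreeDimensionLT.closure`). If n + 1 < d, a
cosyzygy raises n by one: the submodule of the free module has no torsion, nor does the quotient, by
the depth estimate. Starting from k with n = 0, the tier of index d - 2 is reached with n = d - 1. A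
maximal Cohen–Macaulay module in it has Γ = 0, so it has finite projective dimension and is free by
the Auslander–Buchsbaum argument. If a tier this low contained all maximal Cohen–Macaulay modules, a
d-th syzygy of k would be free, and Serre's theorem would make R regular.

Filling the tier. Let M be maximal Cohen–Macaulay over an isolated singularity, with a cover F → M
and kernel K. Ischebeck's theorem makes M locally free on the punctured spectrum, so a high power x
of an element of the maximal ideal acts on M through F. This gives an exact sequence 0 → F → K ⊕ M →
K/xK → 0, and M is built from F and K/xK (`closure_of_factor`). The same step modulo a regular
sequence (`closure_quotList`) reduces M, after d rounds, to a module of finite length and to sums of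
quotients of R by regular sequences of length < d. The former lies in the closure of k. The latter
have projective dimension < d and lie in the tier of index d - 1, because projectives are cosyzygies
of zero. -/

namespace ModTier

open Abelian RingTheory.Sequence
open scoped Pointwise

/-! ### Vanishing of Ext, and Rees' theorem -/

section ExtVanishing

variable {R : Type u} [CommRing R]

/-- `Ext^i(N, M) = 0` for all `i < n`. -/
def ExtVanishing (R : Type u) [CommRing R] (N M : Type u) [AddCommGroup N] [Module R N]
    [AddCommGroup M] [Module R M] (n : ℕ) : Prop :=
  ∀ i < n, Subsingleton (Ext (ModuleCat.of R N) (ModuleCat.of R M) i)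

variable {N N₁ N₂ N₃ M M₁ M₂ M₃ : Type u}
  [AddCommGroup N] [Module R N] [AddCommGroup M] [Module R M]
  [AddCommGroup N₁] [Module R N₁] [AddCommGroup M₁] [Module R M₁]
  [AddCommGroup N₂] [Module R N₂] [AddCommGroup M₂] [Module R M₂]
  [AddCommGroup N₃] [Module R N₃] [AddCommGroup M₃] [Module R M₃]

/-- The short complex of `R`-modules attached to an exact pair of linear maps. -/
abbrev exactShortComplex {f : M₁ →ₗ[R] M₂} {g : M₂ →ₗ[R] M₃} (hfg : Function.Exact f g) :
    ShortComplex (ModuleCat.{u} R) :=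
  ModuleCat.shortComplexOfCompEqZero f g hfg.linearMap_comp_eq_zero

lemma exactShortComplex_shortExact {f : M₁ →ₗ[R] M₂} {g : M₂ →ₗ[R] M₃}
    (hf : Function.Injective f) (hfg : Function.Exact f g) (hg : Function.Surjective g) :
    (exactShortComplex hfg).ShortExact :=
  ModuleCat.shortComplex_shortExact _ hfg hf hg

lemma ExtVanishing.mono {m n : ℕ} (h : ExtVanishing R N M n) (hmn : m ≤ n) :
    ExtVanishing R N M m :=
  fun i hi => h i (hi.trans_le hmn)

lemma subsingleton_ext_of_subsingleton_right [Subsingleton M] (i : ℕ) :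
    Subsingleton (Ext (ModuleCat.of R N) (ModuleCat.of R M) i) := by
  refine ⟨fun a b => ?_⟩
  have h0 : (𝟙 (ModuleCat.of R M)) = 0 := by
    ext x
    exact Subsingleton.elim _ _
  rw [← Ext.comp_mk₀_id a, ← Ext.comp_mk₀_id b, h0]
  simp

lemma subsingleton_ext_of_subsingleton_left [Subsingleton N] (i : ℕ) :
    Subsingleton (Ext (ModuleCat.of R N) (ModuleCat.of R M) i) := by
  refine ⟨fun a b => ?_⟩
  have h0 : (𝟙 (ModuleCat.of R N)) = 0 := by
    ext x
    exact Subsingleton.elim _ _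
  rw [← Ext.mk₀_id_comp a, ← Ext.mk₀_id_comp b, h0]
  simp

lemma subsingleton_ext_middle {f : M₁ →ₗ[R] M₂} {g : M₂ →ₗ[R] M₃}
    (hf : Function.Injective f) (hfg : Function.Exact f g) (hg : Function.Surjective g) {i : ℕ}
    (h₁ : Subsingleton (Ext (ModuleCat.of R N) (ModuleCat.of R M₁) i))
    (h₃ : Subsingleton (Ext (ModuleCat.of R N) (ModuleCat.of R M₃) i)) :
    Subsingleton (Ext (ModuleCat.of R N) (ModuleCat.of R M₂) i) := by
  refine subsingleton_of_forall_eq 0 fun x => ?_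
  obtain ⟨y, rfl⟩ := Ext.covariant_sequence_exact₂ _ (exactShortComplex_shortExact hf hfg hg) x
    (Subsingleton.elim (α := Ext (ModuleCat.of R N) (ModuleCat.of R M₃) i) _ _)
  rw [Subsingleton.elim (α := Ext (ModuleCat.of R N) (ModuleCat.of R M₁) i) y 0, Ext.zero_comp]

lemma subsingleton_ext_left {f : M₁ →ₗ[R] M₂} {g : M₂ →ₗ[R] M₃}
    (hf : Function.Injective f) (hfg : Function.Exact f g) (hg : Function.Surjective g) {i : ℕ}
    (h₂ : Subsingleton (Ext (ModuleCat.of R N) (ModuleCat.of R M₂) (i + 1)))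
    (h₃ : Subsingleton (Ext (ModuleCat.of R N) (ModuleCat.of R M₃) i)) :
    Subsingleton (Ext (ModuleCat.of R N) (ModuleCat.of R M₁) (i + 1)) := by
  refine subsingleton_of_forall_eq 0 fun x => ?_
  obtain ⟨y, rfl⟩ := Ext.covariant_sequence_exact₁ _ (exactShortComplex_shortExact hf hfg hg) x
    (Subsingleton.elim (α := Ext (ModuleCat.of R N) (ModuleCat.of R M₂) (i + 1)) _ _) rfl
  rw [Subsingleton.elim (α := Ext (ModuleCat.of R N) (ModuleCat.of R M₃) i) y 0, Ext.zero_comp]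

lemma subsingleton_ext_right {f : M₁ →ₗ[R] M₂} {g : M₂ →ₗ[R] M₃}
    (hf : Function.Injective f) (hfg : Function.Exact f g) (hg : Function.Surjective g) {i : ℕ}
    (h₂ : Subsingleton (Ext (ModuleCat.of R N) (ModuleCat.of R M₂) i))
    (h₁ : Subsingleton (Ext (ModuleCat.of R N) (ModuleCat.of R M₁) (i + 1))) :
    Subsingleton (Ext (ModuleCat.of R N) (ModuleCat.of R M₃) i) := by
  refine subsingleton_of_forall_eq 0 fun x => ?_
  obtain ⟨y, rfl⟩ := Ext.covariant_sequence_exact₃ _ (exactShortComplex_shortExact hf hfg hg) x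
    rfl (Subsingleton.elim (α := Ext (ModuleCat.of R N) (ModuleCat.of R M₁) (i + 1)) _ _)
  rw [Subsingleton.elim (α := Ext (ModuleCat.of R N) (ModuleCat.of R M₂) i) y 0, Ext.zero_comp]

lemma subsingleton_ext_zero_of_injective {f : M₁ →ₗ[R] M₂} (hf : Function.Injective f)
    (h₂ : Subsingleton (Ext (ModuleCat.of R N) (ModuleCat.of R M₂) 0)) :
    Subsingleton (Ext (ModuleCat.of R N) (ModuleCat.of R M₁) 0) := by
  have : Mono (ModuleCat.ofHom f) := (ModuleCat.mono_iff_injective _).2 hf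
  exact (Ext.postcomp_mk₀_injective_of_mono (ModuleCat.of R N) (ModuleCat.ofHom f)).subsingleton

lemma subsingleton_ext_middle_of_exact_left {f : N₁ →ₗ[R] N₂} {g : N₂ →ₗ[R] N₃}
    (hf : Function.Injective f) (hfg : Function.Exact f g) (hg : Function.Surjective g) {i : ℕ}
    (h₁ : Subsingleton (Ext (ModuleCat.of R N₁) (ModuleCat.of R M) i))
    (h₃ : Subsingleton (Ext (ModuleCat.of R N₃) (ModuleCat.of R M) i)) :
    Subsingleton (Ext (ModuleCat.of R N₂) (ModuleCat.of R M) i) := by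
  refine subsingleton_of_forall_eq 0 fun x => ?_
  obtain ⟨y, rfl⟩ := Ext.contravariant_sequence_exact₂ (exactShortComplex_shortExact hf hfg hg) _ x
    (Subsingleton.elim (α := Ext (ModuleCat.of R N₁) (ModuleCat.of R M) i) _ _)
  rw [Subsingleton.elim (α := Ext (ModuleCat.of R N₃) (ModuleCat.of R M) i) y 0, Ext.comp_zero]

lemma subsingleton_ext_congr (e : N₁ ≃ₗ[R] N₂) (e' : M₁ ≃ₗ[R] M₂) {i : ℕ}
    (h : Subsingleton (Ext (ModuleCat.of R N₁) (ModuleCat.of R M₁) i)) :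
    Subsingleton (Ext (ModuleCat.of R N₂) (ModuleCat.of R M₂) i) := by
  have h1 : Subsingleton (Ext (ModuleCat.of R N₁) (ModuleCat.of R M₂) i) := by
    refine subsingleton_ext_middle (f := e'.toLinearMap) (g := (0 : M₂ →ₗ[R] PUnit.{u+1}))
      e'.injective ?_ (fun x => ⟨0, Subsingleton.elim _ _⟩) h
      (subsingleton_ext_of_subsingleton_right i)
    exact fun y => ⟨fun _ => e'.surjective y, fun _ => rfl⟩
  refine subsingleton_ext_middle_of_exact_left (f := e.toLinearMap)
    (g := (0 : N₂ →ₗ[R] PUnit.{u+1}))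
    e.injective ?_ (fun x => ⟨0, Subsingleton.elim _ _⟩) h1
    (subsingleton_ext_of_subsingleton_left i)
  exact fun y => ⟨fun _ => e.surjective y, fun _ => rfl⟩

lemma ExtVanishing.congr {n : ℕ} (e : N₁ ≃ₗ[R] N₂) (e' : M₁ ≃ₗ[R] M₂)
    (h : ExtVanishing R N₁ M₁ n) : ExtVanishing R N₂ M₂ n :=
  fun i hi => subsingleton_ext_congr e e' (h i hi)

lemma ExtVanishing.middle {n : ℕ} {f : M₁ →ₗ[R] M₂} {g : M₂ →ₗ[R] M₃}
    (hf : Function.Injective f) (hfg : Function.Exact f g) (hg : Function.Surjective g)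
    (h₁ : ExtVanishing R N M₁ n) (h₃ : ExtVanishing R N M₃ n) : ExtVanishing R N M₂ n :=
  fun i hi => subsingleton_ext_middle hf hfg hg (h₁ i hi) (h₃ i hi)

lemma ExtVanishing.left {n : ℕ} {f : M₁ →ₗ[R] M₂} {g : M₂ →ₗ[R] M₃}
    (hf : Function.Injective f) (hfg : Function.Exact f g) (hg : Function.Surjective g)
    (h₂ : ExtVanishing R N M₂ n) (h₃ : ExtVanishing R N M₃ (n - 1)) : ExtVanishing R N M₁ n := by
  rintro (_ | i) hi
  · exact subsingleton_ext_zero_of_injective hf (h₂ 0 hi)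
  · exact subsingleton_ext_left hf hfg hg (h₂ _ hi) (h₃ i (by lia))

lemma ExtVanishing.right {n : ℕ} {f : M₁ →ₗ[R] M₂} {g : M₂ →ₗ[R] M₃}
    (hf : Function.Injective f) (hfg : Function.Exact f g) (hg : Function.Surjective g)
    (h₂ : ExtVanishing R N M₂ n) (h₁ : ExtVanishing R N M₁ (n + 1)) : ExtVanishing R N M₃ n :=
  fun i hi => subsingleton_ext_right hf hfg hg (h₂ i hi) (h₁ _ (by lia))

lemma ExtVanishing.of_injective_one {f : M₁ →ₗ[R] M₂} (hf : Function.Injective f)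
    (h₂ : ExtVanishing R N M₂ 1) : ExtVanishing R N M₁ 1 := by
  intro i hi
  obtain rfl : i = 0 := by lia
  exact subsingleton_ext_zero_of_injective hf (h₂ 0 hi)

lemma ExtVanishing.prod {n : ℕ} (h₁ : ExtVanishing R N M₁ n) (h₂ : ExtVanishing R N M₂ n) :
    ExtVanishing R N (M₁ × M₂) n :=
  .middle (f := LinearMap.inl R M₁ M₂) (g := LinearMap.snd R M₁ M₂) LinearMap.inl_injective
    (LinearMap.exact_iff.2 (LinearMap.ker_snd R M₁ M₂)) LinearMap.snd_surjective h₁ h₂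

lemma subsingleton_ext_of_retract {i : M₁ →ₗ[R] M₂} {p : M₂ →ₗ[R] M₁}
    (h : p ∘ₗ i = LinearMap.id) {n : ℕ}
    (h₂ : Subsingleton (Ext (ModuleCat.of R N) (ModuleCat.of R M₂) n)) :
    Subsingleton (Ext (ModuleCat.of R N) (ModuleCat.of R M₁) n) := by
  refine subsingleton_of_forall_eq 0 fun x => ?_
  have h1 : ModuleCat.ofHom i ≫ ModuleCat.ofHom p = 𝟙 (ModuleCat.of R M₁) := by
    rw [← ModuleCat.ofHom_comp, h, ModuleCat.ofHom_id]
  rw [← Ext.comp_mk₀_id x, ← h1, ← Ext.mk₀_comp_mk₀,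
    ← Ext.comp_assoc_of_third_deg_zero,
    Subsingleton.elim (x.comp (Ext.mk₀ (ModuleCat.ofHom i)) (add_zero n)) 0,
    Ext.zero_comp]

lemma ExtVanishing.of_retract {i : M₁ →ₗ[R] M₂} {p : M₂ →ₗ[R] M₁}
    (h : p ∘ₗ i = LinearMap.id) {n : ℕ} (h₂ : ExtVanishing R N M₂ n) : ExtVanishing R N M₁ n :=
  fun j hj => subsingleton_ext_of_retract h (h₂ j hj)

lemma ExtVanishing.pi {n : ℕ} (h : ExtVanishing R N M n) (m : ℕ) :
    ExtVanishing R N (Fin m → M) n := by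
  induction m with
  | zero => exact fun i _ => subsingleton_ext_of_subsingleton_right i
  | succ m ih => exact (h.prod ih).congr (.refl R N) (Fin.consLinearEquiv R fun _ => M)

lemma ExtVanishing.of_projective {n : ℕ} (h : ExtVanishing R N R n) [Module.Finite R M]
    [Module.Projective R M] : ExtVanishing R N M n := by
  obtain ⟨m, p, hp⟩ := Module.Finite.exists_fin' R M
  obtain ⟨i, hi⟩ := Module.projective_lifting_property p LinearMap.id hp
  exact (h.pi m).of_retract hi

lemma extVanishing_one_iff : ExtVanishing R N M 1 ↔ Subsingleton (N →ₗ[R] M) := by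
  have h : Subsingleton (Ext (ModuleCat.of R N) (ModuleCat.of R M) 0) ↔
      Subsingleton (N →ₗ[R] M) :=
    (Ext.homEquiv₀.trans ModuleCat.homEquiv).subsingleton_congr
  rw [← h]
  refine ⟨fun H => H 0 one_pos, fun H i hi => ?_⟩
  obtain rfl : i = 0 := by lia
  exact H

lemma smul_ext_eq_zero {r : R} (hr : r ∈ Module.annihilator R N) {i : ℕ}
    (x : Ext (ModuleCat.of R N) (ModuleCat.of R M) i) : r • x = 0 := by
  have h0 : r • 𝟙 (ModuleCat.of R N) = 0 := by
    ext y
    exact Module.mem_annihilator.1 hr y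
  rw [← Ext.mk₀_id_comp x, ← Ext.smul_comp, ← Ext.mk₀_smul, h0, Ext.mk₀_zero, Ext.zero_comp]

lemma quotSMulTop_exact (x : R) :
    Function.Exact (LinearMap.lsmul R M x) (Submodule.mkQ (x • (⊤ : Submodule R M))) :=
  LinearMap.exact_lsmul_mkQ_smul_top M x

lemma ExtVanishing.quotSMulTop {n : ℕ} {x : R} (hx : IsSMulRegular M x)
    (h : ExtVanishing R N M (n + 1)) : ExtVanishing R N (QuotSMulTop x M) n :=
  .right (f := LinearMap.lsmul R M x) hx (quotSMulTop_exact x) (Submodule.mkQ_surjective _)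
    (h.mono n.le_succ) h

lemma ExtVanishing.of_quotSMulTop {n : ℕ} {x : R} (hx : IsSMulRegular M x)
    (hxN : x ∈ Module.annihilator R N) (h : ExtVanishing R N (QuotSMulTop x M) n) :
    ExtVanishing R N M (n + 1) := by
  have key (i : ℕ) (y : Ext (ModuleCat.of R N) (ModuleCat.of R M) i) :
      y.comp (Ext.mk₀ (ModuleCat.ofHom (LinearMap.lsmul R M x))) (add_zero i) = 0 := by
    have : ModuleCat.ofHom (LinearMap.lsmul R M x) = x • 𝟙 (ModuleCat.of R M) := rfl
    rw [this, ← Ext.smul_eq_comp_mk₀, smul_ext_eq_zero hxN]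
  rintro (_ | i) hi
  · have : Mono (ModuleCat.ofHom (LinearMap.lsmul R M x)) := (ModuleCat.mono_iff_injective _).2 hx
    refine subsingleton_of_forall_eq 0 fun y => ?_
    exact Ext.postcomp_mk₀_injective_of_mono _ (ModuleCat.ofHom (LinearMap.lsmul R M x))
      ((key 0 y).trans (key 0 0).symm)
  · refine subsingleton_of_forall_eq 0 fun y => ?_
    obtain ⟨z, rfl⟩ := Ext.covariant_sequence_exact₁ _ (exactShortComplex_shortExact
      (f := LinearMap.lsmul R M x) hx (quotSMulTop_exact x) (Submodule.mkQ_surjective _)) y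
      (key _ y) rfl
    have := h i (by lia)
    rw [Subsingleton.elim (α := Ext (ModuleCat.of R N) (ModuleCat.of R (QuotSMulTop x M)) i) z 0,
      Ext.zero_comp]

/-- One direction of Rees' theorem. -/
lemma ExtVanishing.of_isWeaklyRegular {rs : List R} (hrs : IsWeaklyRegular M rs)
    (hN : ∀ r ∈ rs, r ∈ Module.annihilator R N) : ExtVanishing R N M rs.length := by
  induction rs generalizing M with
  | nil => exact fun i hi => absurd hi (by simp)
  | cons x rs ih =>
    rw [isWeaklyRegular_cons_iff] at hrs
    exact (ih hrs.2 fun r hr => hN r (by simp [hr])).of_quotSMulTop hrs.1 (hN x (by simp))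

/-- The other direction of Rees' theorem. -/
lemma ExtVanishing.exists_isWeaklyRegular [IsNoetherianRing R] [Module.Finite R N]
    [Module.Finite R M] {n : ℕ} (h : ExtVanishing R N M n) :
    ∃ rs : List R, rs.length = n ∧ (∀ r ∈ rs, r ∈ Module.annihilator R N) ∧
      IsWeaklyRegular M rs := by
  induction n generalizing M with
  | zero => exact ⟨[], rfl, by simp, .nil R M⟩
  | succ n ih =>
    obtain ⟨x, hxN, hx⟩ := IsSMulRegular.subsingleton_linearMap_iff.1
      (extVanishing_one_iff.1 (h.mono (by lia : 1 ≤ n + 1)))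
    obtain ⟨rs, hl, hrs, hreg⟩ := ih (h.quotSMulTop hx)
    refine ⟨x :: rs, by simp [hl], by simpa [hxN] using hrs, ?_⟩
    exact (isWeaklyRegular_cons_iff M x rs).2 ⟨hx, hreg⟩

/-- The kernel on Ext^d is the image of the connecting map from Ext^{d-1}(N, M₃) = 0; in degree 0 it
is left exactness of Hom. Set against minimality of a cover, which makes the same map zero, this
forces the kernel of the cover to vanish. -/
lemma ext_comp_injective {f : M₁ →ₗ[R] M₂} {g : M₂ →ₗ[R] M₃}
    (hf : Function.Injective f) (hfg : Function.Exact f g) (hg : Function.Surjective g) {d : ℕ}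
    (h : ExtVanishing R N M₃ d) (x : Ext (ModuleCat.of R N) (ModuleCat.of R M₁) d)
    (hx : x.comp (Ext.mk₀ (ModuleCat.ofHom f)) (add_zero d) = 0) : x = 0 := by
  cases d with
  | zero =>
    have : Mono (ModuleCat.ofHom f) := (ModuleCat.mono_iff_injective _).2 hf
    exact Ext.postcomp_mk₀_injective_of_mono _ (ModuleCat.ofHom f)
      (hx.trans (by simp : (0 : Ext (ModuleCat.of R N) (ModuleCat.of R M₁) 0).comp
        (Ext.mk₀ (ModuleCat.ofHom f)) (add_zero 0) = 0).symm)
  | succ i =>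
    obtain ⟨z, rfl⟩ := Ext.covariant_sequence_exact₁ _ (exactShortComplex_shortExact hf hfg hg) x
      hx rfl
    have := h i (by lia)
    rw [Subsingleton.elim (α := Ext (ModuleCat.of R N) (ModuleCat.of R M₃) i) z 0, Ext.zero_comp]

lemma kernel_exact (f : M →ₗ[R] M₁) : Function.Exact (LinearMap.ker f).subtype f :=
  LinearMap.exact_subtype_ker_map f

lemma hasProjectiveDimensionLT_one_iff :
    HasProjectiveDimensionLT (ModuleCat.of R M) 1 ↔ Module.Projective R M := by
  rw [← projective_iff_hasProjectiveDimensionLT_one, ← IsProjective.iff_projective]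

lemma hasProjectiveDimensionLT_zero_iff :
    HasProjectiveDimensionLT (ModuleCat.of R M) 0 ↔ Subsingleton M := by
  rw [hasProjectiveDimensionLT_zero_iff_isZero, ModuleCat.isZero_iff_subsingleton]

lemma hasProjectiveDimensionLT_succ_succ_iff {f : M₁ →ₗ[R] M₂} {g : M₂ →ₗ[R] M₃}
    (hf : Function.Injective f) (hfg : Function.Exact f g) (hg : Function.Surjective g)
    [Module.Projective R M₂] {n : ℕ} :
    HasProjectiveDimensionLT (ModuleCat.of R M₃) (n + 2) ↔
      HasProjectiveDimensionLT (ModuleCat.of R M₁) (n + 1) :=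
  (exactShortComplex_shortExact hf hfg hg).hasProjectiveDimensionLT_X₃_iff n
    ((IsProjective.iff_projective (R := R) M₂).1 ‹_›)

end ExtVanishing

/-! ### Depth over local rings: Ischebeck and Auslander–Buchsbaum -/

section LocalDepth

variable {R : Type u} [CommRing R] [IsLocalRing R]
variable {N N₁ N₂ N₃ M M₁ M₂ M₃ : Type u}
  [AddCommGroup N] [Module R N] [AddCommGroup M] [Module R M]
  [AddCommGroup M₁] [Module R M₁] [AddCommGroup M₂] [Module R M₂]
  [AddCommGroup M₃] [Module R M₃]

variable (R) in
lemma annihilator_residueField : Module.annihilator R (ResidueField R) = maximalIdeal R :=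
  Ideal.annihilator_quotient (I := maximalIdeal R)

variable (R) in
/-- The quotient by the maximal ideal is the residue field. -/
noncomputable def quotientMaximalIdealEquiv : (R ⧸ maximalIdeal R) ≃ₗ[R] ResidueField R :=
  LinearEquiv.refl R (R ⧸ maximalIdeal R)

instance : Module.Finite R (ResidueField R) :=
  Module.Finite.equiv (quotientMaximalIdealEquiv R)

/-- Ischebeck's theorem. -/
lemma ExtVanishing.of_supportDim_le [IsNoetherianRing R] [Module.Finite R M] {n : ℕ}
    (h : ExtVanishing R (ResidueField R) M n) (s : ℕ) [hN : Module.Finite R N]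
    (hs : Module.supportDim R N ≤ s) : ExtVanishing R N M (n - s) := by
  induction s using Nat.strong_induction_on generalizing N with
  | _ s ih =>
  induction hN using IsNoetherianRing.induction_on_isQuotientEquivQuotientPrime with
  | subsingleton N => exact fun i _ => subsingleton_ext_of_subsingleton_left i
  | exact N₁ N₂ N₃ f g hf hg hfg h₁ h₃ =>
    exact fun i hi => subsingleton_ext_middle_of_exact_left hf hfg hg
      (h₁ ((Module.supportDim_le_of_injective f hf).trans hs) i hi)
      (h₃ ((Module.supportDim_le_of_surjective g hg).trans hs) i hi)
  | quotient N q e =>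
    by_cases hq : q.asIdeal = maximalIdeal R
    · exact (h.congr ((quotientMaximalIdealEquiv R).symm.trans
        ((Submodule.quotEquivOfEq _ _ hq.symm).trans e.symm)) (.refl R M)).mono (Nat.sub_le _ _)
    obtain ⟨x, hxm, hxq⟩ : ∃ x ∈ maximalIdeal R, x ∉ q.asIdeal := by
      by_contra! hcon
      exact hq (le_antisymm (le_maximalIdeal q.2.ne_top) hcon)
    have hreg : IsSMulRegular N x := by
      rw [e.isSMulRegular_congr, isSMulRegular_iff_right_eq_zero_of_smul]
      intro y hy
      obtain ⟨y, rfl⟩ := Ideal.Quotient.mk_surjective y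
      rw [← Ideal.Quotient.mkₐ_eq_mk R, ← map_smul, Ideal.Quotient.mkₐ_eq_mk,
        Ideal.Quotient.eq_zero_iff_mem, smul_eq_mul] at hy
      exact Ideal.Quotient.eq_zero_iff_mem.2 ((q.2.mem_or_mem hy).resolve_left hxq)
    have : Nontrivial N := by
      have := Ideal.Quotient.nontrivial_iff.2 q.2.ne_top
      exact e.toEquiv.nontrivial
    have hdim := Module.supportDim_quotSMulTop_succ_eq_supportDim hreg hxm
    have : Nontrivial (QuotSMulTop x N) := nontrivial_quotSMulTop_of_mem_maximalIdeal N hxm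
    have h0 : Module.supportDim R (QuotSMulTop x N) ≠ ⊥ :=
      Module.supportDim_ne_bot_of_nontrivial R _
    obtain ⟨s, rfl⟩ : ∃ t, s = t + 1 := by
      refine Nat.exists_eq_succ_of_ne_zero ?_
      rintro rfl
      rw [← hdim, Nat.cast_zero, ENat.WithBot.add_one_le_zero_iff] at hs
      exact h0 hs
    have hs' : Module.supportDim R (QuotSMulTop x N) ≤ s := by
      rw [← hdim, Nat.cast_add, Nat.cast_one] at hs
      exact (ENat.WithBot.add_le_add_natCast_right_iff (c := 1)).1 (by simpa using hs)
    intro i hi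
    have hquot := ih s (by lia) (N := QuotSMulTop x N) hs' (i + 1) (by lia)
    by_contra hcon
    rw [not_subsingleton_iff_nontrivial] at hcon
    -- The cokernel of x on Ext^i(N, M) embeds in Ext^{i+1}(N/xN, M), which is zero because N/xN has
    -- smaller dimension. Nakayama then kills Ext^i(N, M).
    have hnak := Submodule.top_ne_pointwise_smul_of_mem_jacobson_annihilator
      (R := R) (M := Ext (ModuleCat.of R N) (ModuleCat.of R M) i)
      ((maximalIdeal_le_jacobson _) hxm)
    refine hnak (eq_comm.1 (eq_top_iff.2 fun y _ => ?_))
    obtain ⟨z, hz⟩ := Ext.contravariant_sequence_exact₁ (exactShortComplex_shortExact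
      (f := LinearMap.lsmul R N x) hreg (quotSMulTop_exact x) (Submodule.mkQ_surjective _)) _ y
      (add_comm 1 i) (Subsingleton.elim
        (α := Ext (ModuleCat.of R (QuotSMulTop x N)) (ModuleCat.of R M) (i + 1)) _ _)
    have : ModuleCat.ofHom (LinearMap.lsmul R N x) = x • 𝟙 (ModuleCat.of R N) := rfl
    change (Ext.mk₀ (ModuleCat.ofHom (LinearMap.lsmul R N x))).comp z _ = y at hz
    rw [this, Ext.mk₀_smul, Ext.smul_comp, Ext.mk₀_id_comp] at hz
    rw [← hz]
    exact Submodule.smul_mem_pointwise_smul _ _ ⊤ trivial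

/-- Ischebeck's theorem applied to N = M gives Hom(M, M) = 0, so the identity is zero. This
expresses that the depth of a nonzero module is at most the dimension of the ring. -/
lemma subsingleton_of_extVanishing [IsNoetherianRing R] [Module.Finite R M] {d n : ℕ}
    (hd : ringKrullDim R ≤ d) (hdn : d < n) (h : ExtVanishing R (ResidueField R) M n) :
    Subsingleton M := by
  have := extVanishing_one_iff.1 <| (h.of_supportDim_le d (N := M)
    ((Module.supportDim_le_ringKrullDim R M).trans hd)).mono (by lia : 1 ≤ n - d)
  exact subsingleton_of_forall_eq 0 fun x =>
    congr($(Subsingleton.elim (LinearMap.id : M →ₗ[R] M) 0) x)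

lemma extVanishing_iff_exists [IsNoetherianRing R] [Module.Finite R M] {n : ℕ} :
    ExtVanishing R (ResidueField R) M n ↔
      ∃ rs : List R, rs.length = n ∧ (∀ r ∈ rs, r ∈ maximalIdeal R) ∧ IsWeaklyRegular M rs := by
  refine ⟨fun h => by simpa [annihilator_residueField] using h.exists_isWeaklyRegular, ?_⟩
  rintro ⟨rs, rfl, hrs, hreg⟩
  exact .of_isWeaklyRegular hreg (by simpa [annihilator_residueField] using hrs)

lemma le_depth_iff [IsNoetherianRing R] [Module.Finite R M] {n : ℕ} :
    (n : ℕ∞) ≤ depth R M ↔ ExtVanishing R (ResidueField R) M n := by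
  rw [extVanishing_iff_exists]
  constructor
  · intro h
    cases n with
    | zero => exact ⟨[], rfl, by simp, .nil R M⟩
    | succ n =>
      have h' : (n : ℕ∞) < depth R M :=
        lt_of_lt_of_le (by exact_mod_cast n.lt_succ_self) h
      simp only [depth, lt_iSup_iff, Nat.cast_lt] at h'
      obtain ⟨rs, hrs, hreg, hl⟩ := h'
      have := extVanishing_iff_exists.1 ((extVanishing_iff_exists.2 ⟨rs, rfl, hrs, hreg⟩).mono
        (Nat.succ_le_of_lt hl))
      exact this
  · rintro ⟨rs, rfl, hrs, hreg⟩
    exact le_iSup_of_le rs (le_iSup_of_le hrs (le_iSup_of_le hreg le_rfl))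

/-- The second, negated condition excludes the zero module, whose depth is infinite. -/
lemma isMaximalCohenMacaulay_iff [IsNoetherianRing R] {d : ℕ} (hd : ringKrullDim R = d) :
    IsMaximalCohenMacaulay R M ↔ Module.Finite R M ∧ ExtVanishing R (ResidueField R) M d ∧
      ¬ ExtVanishing R (ResidueField R) M (d + 1) := by
  refine and_congr_right fun _ => ?_
  rw [hd, ← le_depth_iff, ← le_depth_iff, not_le]
  have : ((d + 1 : ℕ) : ℕ∞) = (d : ℕ∞) + 1 := by push_cast; rfl
  rw [this, ENat.lt_add_one_iff (by simp)]
  have h2 : ((depth R M : ℕ∞) : WithBot ℕ∞) = ((d : ℕ) : WithBot ℕ∞) ↔ depth R M = d := by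
    rw [show ((d : ℕ) : WithBot ℕ∞) = ((d : ℕ∞) : WithBot ℕ∞) from rfl, WithBot.coe_inj]
  rw [h2, le_antisymm_iff, and_comm]

variable (M) in
/-- Finitely generated modules over local rings have minimal covers. -/
lemma exists_minimal_cover [Module.Finite R M] :
    ∃ (n : ℕ) (f : (Fin n → R) →ₗ[R] M), Function.Surjective f ∧
      ∀ v ∈ LinearMap.ker f, ∀ i, v i ∈ maximalIdeal R := by
  let b := Module.finBasis (ResidueField R) (TensorProduct R (ResidueField R) M)
  have hs : Function.Surjective (TensorProduct.mk R (ResidueField R) M 1) :=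
    TensorProduct.mk_surjective R M (ResidueField R) Ideal.Quotient.mk_surjective
  choose m hm using fun i => hs (b i)
  refine ⟨_, Fintype.linearCombination R m, ?_, fun v hv i => ?_⟩
  · rw [← LinearMap.range_eq_top, Fintype.range_linearCombination]
    exact span_eq_top_of_tmul_eq_basis m b hm
  · rw [LinearMap.mem_ker, Fintype.linearCombination_apply] at hv
    have h0 := congr(TensorProduct.mk R (ResidueField R) M 1 $hv)
    rw [map_sum, map_zero] at h0
    have h1 : ∑ i, (residue R (v i)) • b i = 0 := by
      rw [← h0]
      refine Finset.sum_congr rfl fun i _ => ?_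
      rw [map_smul, hm, ← ResidueField.algebraMap_eq, algebraMap_smul]
    have h2 := Fintype.linearIndependent_iff.1 b.linearIndependent _ h1 i
    exact (residue_eq_zero_iff _).1 h2

/-- A map of free modules with entries in the maximal ideal induces zero on `Ext(k, -)`. -/
lemma ext_comp_eq_zero_of_minimal {m n : ℕ} (f : (Fin m → R) →ₗ[R] (Fin n → R))
    (hf : ∀ v i, f v i ∈ maximalIdeal R) {i : ℕ}
    (x : Ext (ModuleCat.of R (ResidueField R)) (ModuleCat.of R (Fin m → R)) i) :
    x.comp (Ext.mk₀ (ModuleCat.ofHom f)) (add_zero i) = 0 := by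
  have key : ∀ g ∈ maximalIdeal R • (⊤ : Submodule R ((Fin m → R) →ₗ[R] (Fin n → R))),
      x.comp (Ext.mk₀ (ModuleCat.ofHom g)) (add_zero i) = 0 := by
    intro g hg
    induction hg using Submodule.smul_induction_on' with
    | smul r hr g _ =>
      have : ModuleCat.ofHom (r • g) = r • ModuleCat.ofHom g := rfl
      rw [this, Ext.mk₀_smul, Ext.comp_smul]
      exact smul_ext_eq_zero (by rwa [annihilator_residueField]) _
    | add g _ g' _ h h' =>
      have : ModuleCat.ofHom (g + g') = ModuleCat.ofHom g + ModuleCat.ofHom g' := rfl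
      rw [this, Ext.mk₀_add, Ext.comp_add, h, h', add_zero]
  refine key f ?_
  have : f = ∑ j, ∑ l, (f (Pi.single j 1) l) • Matrix.toLin' (Matrix.single l j (1 : R)) := by
    conv_lhs => rw [← Matrix.toLin'_toMatrix' f, Matrix.matrix_eq_sum_single
      (LinearMap.toMatrix' f), map_sum]
    simp_rw [map_sum]
    rw [Finset.sum_comm]
    refine Finset.sum_congr rfl fun j _ => Finset.sum_congr rfl fun l _ => ?_
    rw [← map_smul, Matrix.smul_single, smul_eq_mul, mul_one, LinearMap.toMatrix'_apply]
  rw [this]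
  exact Submodule.sum_mem _ fun j _ => Submodule.sum_mem _ fun l _ =>
    Submodule.smul_mem_smul (hf _ _) trivial

/-- Over a local ring `R` of depth `d`, modules of depth at least `d` and of finite projective
dimension are free. -/
lemma free_of_hasProjectiveDimensionLT [IsNoetherianRing R] {d : ℕ}
    (hR : ExtVanishing R (ResidueField R) R d) (hR' : ¬ ExtVanishing R (ResidueField R) R (d + 1))
    {n : ℕ} [Module.Finite R M] (hM : ExtVanishing R (ResidueField R) M d)
    (hn : HasProjectiveDimensionLT (ModuleCat.of R M) n) : Module.Free R M := by
  induction n generalizing M with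
  | zero =>
    have := hasProjectiveDimensionLT_zero_iff.1 hn
    infer_instance
  | succ n ih =>
    cases n with
    | zero =>
      have := hasProjectiveDimensionLT_one_iff.1 hn
      exact Module.free_of_flat_of_isLocalRing
    | succ n =>
      obtain ⟨m, f, hf, hmin⟩ := exists_minimal_cover M (R := R)
      have hK : ExtVanishing R (ResidueField R) (LinearMap.ker f) d :=
        .left (Submodule.subtype_injective _) (kernel_exact f) hf (hR.pi m) (hM.mono (by lia))
      have : Module.Free R (LinearMap.ker f) := ih hK
        ((hasProjectiveDimensionLT_succ_succ_iff (Submodule.subtype_injective _)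
          (kernel_exact f) hf).1 hn)
      let b := Module.finBasis R (LinearMap.ker f)
      -- The inclusion of the kernel into the cover has entries in the maximal ideal, so it induces
      -- zero on Ext^d(k, -). It is also injective there, as M has depth at least d. A nonzero free
      -- kernel would have R as a summand and force Ext^d(k, R) = 0.
      have hsub : Subsingleton (Ext (ModuleCat.of R (ResidueField R))
          (ModuleCat.of R (Fin (Module.finrank R (LinearMap.ker f)) → R)) d) := by
        refine subsingleton_of_forall_eq 0 fun x => ?_
        refine ext_comp_injective
          (f := (LinearMap.ker f).subtype ∘ₗ b.equivFun.symm.toLinearMap) (g := f)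
          ((Submodule.subtype_injective _).comp b.equivFun.symm.injective) ?_ hf hM x ?_
        · intro y
          rw [kernel_exact f y]
          simp only [LinearMap.coe_comp, Set.mem_range, Function.comp_apply]
          constructor
          · rintro ⟨y, rfl⟩
            exact ⟨b.equivFun y, by simp⟩
          · rintro ⟨y, rfl⟩
            exact ⟨_, rfl⟩
        · exact ext_comp_eq_zero_of_minimal _ (fun v i => hmin _ (b.equivFun.symm v).2 i) x
      have hfr : Module.finrank R (LinearMap.ker f) = 0 := by
        by_contra hne
        let j : Fin (Module.finrank R (LinearMap.ker f)) := ⟨0, Nat.pos_of_ne_zero hne⟩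
        have := subsingleton_ext_of_retract (i := LinearMap.single R (fun _ => R) j)
          (p := LinearMap.proj j) (by ext; simp) hsub
        refine hR' fun i hi => ?_
        obtain hi | rfl := Nat.lt_succ_iff_lt_or_eq.1 hi
        · exact hR i hi
        · exact this
      have hbot : LinearMap.ker f = ⊥ := by
        have := Module.finrank_eq_zero_iff_of_free (R := R) (M := LinearMap.ker f) |>.1 hfr
        exact (Submodule.subsingleton_iff_eq_bot).1 this
      exact Module.Free.of_equiv (LinearEquiv.ofBijective f ⟨LinearMap.ker_eq_bot.1 hbot, hf⟩)

/-- If the residue field has projective dimension at most `h`, then modules of depth at least `h`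
are free. -/
lemma free_of_hasProjectiveDimensionLT_residueField [IsNoetherianRing R] {d h : ℕ}
    (hd : ringKrullDim R ≤ d)
    (hk : HasProjectiveDimensionLT (ModuleCat.of R (ResidueField R)) (h + 1))
    (hR : ExtVanishing R (ResidueField R) R h) [Module.Finite R M]
    (hM : ExtVanishing R (ResidueField R) M h) : Module.Free R M := by
  obtain ⟨m, f, hf, hmin⟩ := exists_minimal_cover M (R := R)
  have hK : ExtVanishing R (ResidueField R) (LinearMap.ker f) h :=
    .left (Submodule.subtype_injective _) (kernel_exact f) hf (hR.pi m) (hM.mono (by lia))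
  obtain ⟨n, g, hg⟩ := Module.Finite.exists_fin' R (LinearMap.ker f)
  -- As Ext^{h+1}(k, -) = 0, every class in Ext^h(k, ker f) lifts to the free cover of ker f given
  -- by `g`. The composite of free modules has entries in the maximal ideal, so it induces zero,
  -- while ker f → F is injective on Ext^h.
  have hsub : Subsingleton (Ext (ModuleCat.of R (ResidueField R))
      (ModuleCat.of R (LinearMap.ker f)) h) := by
    refine subsingleton_of_forall_eq 0 fun x => ?_
    refine ext_comp_injective (Submodule.subtype_injective _) (kernel_exact f) hf hM x ?_
    obtain ⟨y, rfl⟩ := Ext.covariant_sequence_exact₃ _ (exactShortComplex_shortExact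
      (Submodule.subtype_injective _) (kernel_exact g) hg) x rfl
      (Ext.eq_zero_of_hasProjectiveDimensionLT _ (h + 1) le_rfl)
    rw [Ext.comp_assoc_of_third_deg_zero, Ext.mk₀_comp_mk₀]
    exact ext_comp_eq_zero_of_minimal ((LinearMap.ker f).subtype ∘ₗ g)
      (fun v i => hmin _ (g v).2 i) y
  have hall : ExtVanishing R (ResidueField R) (LinearMap.ker f) (max (h + 1) (d + 1)) := by
    intro i hi
    obtain hi | rfl | hi := lt_trichotomy i h
    · exact hK i hi
    · exact hsub
    · exact HasProjectiveDimensionLT.subsingleton _ (h + 1) i hi _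
  have hbot : LinearMap.ker f = ⊥ := (Submodule.subsingleton_iff_eq_bot).1
    (subsingleton_of_extVanishing hd (by lia) hall)
  exact Module.Free.of_equiv (LinearEquiv.ofBijective f ⟨LinearMap.ker_eq_bot.1 hbot, hf⟩)

/-- The easy inequality of the Auslander–Buchsbaum formula. -/
lemma ExtVanishing.of_hasProjectiveDimensionLT [IsNoetherianRing R] {d : ℕ}
    (hR : ExtVanishing R (ResidueField R) R d) {n : ℕ} [Module.Finite R M]
    (hn : HasProjectiveDimensionLT (ModuleCat.of R M) n) :
    ExtVanishing R (ResidueField R) M (d + 1 - n) := by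
  induction n generalizing M with
  | zero =>
    have := hasProjectiveDimensionLT_zero_iff.1 hn
    exact fun i _ => subsingleton_ext_of_subsingleton_right i
  | succ n ih =>
    cases n with
    | zero =>
      have := hasProjectiveDimensionLT_one_iff.1 hn
      exact hR.of_projective
    | succ n =>
      obtain ⟨m, f, hf⟩ := Module.Finite.exists_fin' R M
      have hK := ih ((hasProjectiveDimensionLT_succ_succ_iff (Submodule.subtype_injective _)
          (kernel_exact f) hf).1 hn)
      intro i hi
      exact subsingleton_ext_right (Submodule.subtype_injective _) (kernel_exact f) hf
        (hR.pi m i (by lia)) (hK _ (by lia))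

end LocalDepth

/-! ### Regular local rings and freeness on the punctured spectrum -/

section Regular

lemma isLocalRing_quotient_span_singleton {R : Type u} [CommRing R] [IsLocalRing R] {x : R}
    (hx : x ∈ maximalIdeal R) :
    IsLocalRing (R ⧸ Ideal.span {x}) := by
  have : Nontrivial (R ⧸ Ideal.span {x}) := Ideal.Quotient.nontrivial_iff.2 fun h =>
    (maximalIdeal.isMaximal R).ne_top (top_le_iff.1 (h ▸ (Ideal.span_singleton_le_iff_mem _).2 hx))
  exact .of_surjective' (Ideal.Quotient.mk _) Ideal.Quotient.mk_surjective

lemma maximalIdeal_quotient {R : Type u} [CommRing R] [IsLocalRing R] {x : R}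
    [IsLocalRing (R ⧸ Ideal.span {x})] :
    maximalIdeal (R ⧸ Ideal.span {x}) = (maximalIdeal R).map (Ideal.Quotient.mk _) := by
  have : IsLocalHom (Ideal.Quotient.mk (Ideal.span {x})) :=
    .of_surjective _ Ideal.Quotient.mk_surjective
  have h := maximalIdeal_comap (Ideal.Quotient.mk (Ideal.span {x}))
  rw [← h, Ideal.map_comap_of_surjective _ Ideal.Quotient.mk_surjective]

variable {R : Type u} [CommRing R] [IsLocalRing R] [IsNoetherianRing R]

lemma spanFinrank_maximalIdeal_le_succ {x : R} (hx : x ∈ maximalIdeal R)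
    [IsLocalRing (R ⧸ Ideal.span {x})] :
    (maximalIdeal R).spanFinrank ≤ (maximalIdeal (R ⧸ Ideal.span {x})).spanFinrank + 1 := by
  classical
  obtain ⟨s, hs, hspan⟩ := Submodule.FG.exists_span_finset_card_eq_spanFinrank
    (maximalIdeal (R ⧸ Ideal.span {x})).fg_of_isNoetherianRing
  let t : Finset R := s.image (Function.surjInv Ideal.Quotient.mk_surjective)
  have ht : Ideal.span ((insert x t : Finset R) : Set R) = maximalIdeal R := by
    have himg : (Ideal.span (t : Set R)).map (Ideal.Quotient.mk (Ideal.span {x})) =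
        (maximalIdeal R).map (Ideal.Quotient.mk _) := by
      rw [← maximalIdeal_quotient, ← hspan, Ideal.map_span, Finset.coe_image, Set.image_image]
      simp only [Function.surjInv_eq, Set.image_id']
    have h2 := congr(Ideal.comap (Ideal.Quotient.mk (Ideal.span {x})) $himg)
    rw [Ideal.comap_map_of_surjective' _ Ideal.Quotient.mk_surjective,
      Ideal.comap_map_of_surjective' _ Ideal.Quotient.mk_surjective, Ideal.mk_ker,
      sup_eq_left.2 ((Ideal.span_singleton_le_iff_mem _).2 hx)] at h2
    rw [← h2, Finset.coe_insert, Ideal.span_insert, sup_comm]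
  calc (maximalIdeal R).spanFinrank ≤ (insert x t : Finset R).card := by
        rw [← ht, ← Set.ncard_coe_finset]
        exact Submodule.spanFinrank_span_le_ncard_of_finite (insert x t : Finset R).finite_toSet
    _ ≤ t.card + 1 := Finset.card_insert_le _ _
    _ ≤ _ := by
        rw [← hs]
        gcongr
        exact Finset.card_image_le

/-- Written in a minimal generating set, x has a unit coefficient because it is outside the square
of the maximal ideal; the corresponding generator is redundant modulo x. -/
lemma spanFinrank_maximalIdeal_quotient_succ_le {x : R} (hx : x ∈ maximalIdeal R)
    (hx2 : x ∉ maximalIdeal R ^ 2) [IsLocalRing (R ⧸ Ideal.span {x})] :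
    (maximalIdeal (R ⧸ Ideal.span {x})).spanFinrank + 1 ≤ (maximalIdeal R).spanFinrank := by
  classical
  obtain ⟨s, hs, hspan⟩ := Submodule.FG.exists_span_finset_card_eq_spanFinrank
    (maximalIdeal R).fg_of_isNoetherianRing
  obtain ⟨c, hc⟩ := Submodule.mem_span_finset'.1 (hspan.symm ▸ hx :
    x ∈ Submodule.span R (s : Set R))
  obtain ⟨y, hy⟩ : ∃ y : s, IsUnit (c y) := by
    by_contra! hcon
    refine hx2 ?_
    rw [← hc, pow_two]
    exact Ideal.sum_mem _ fun y _ => Ideal.mul_mem_mul (hcon y)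
      (hspan ▸ Submodule.subset_span y.2)
  have hmem : ∀ z ∈ s, Ideal.Quotient.mk (Ideal.span {x}) z ∈
      Ideal.span (((s.erase y).image (Ideal.Quotient.mk (Ideal.span {x})) : Finset _) :
        Set (R ⧸ Ideal.span {x})) := by
    intro z hz
    by_cases hzy : z = y
    · subst hzy
      have h0 := congr(Ideal.Quotient.mk (Ideal.span {x}) $hc)
      rw [Ideal.Quotient.eq_zero_iff_mem.2 (Ideal.mem_span_singleton_self x), map_sum,
        ← Finset.add_sum_erase _ _ (Finset.mem_univ y), add_eq_zero_iff_eq_neg] at h0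
      have hu : IsUnit (Ideal.Quotient.mk (Ideal.span {x}) (c y)) := hy.map _
      rw [← Ideal.unit_mul_mem_iff_mem _ hu, ← map_mul, ← smul_eq_mul, h0]
      refine neg_mem (Ideal.sum_mem _ fun w hw => ?_)
      rw [smul_eq_mul, map_mul]
      refine Ideal.mul_mem_left _ _ (Ideal.subset_span (Finset.mem_image_of_mem _ ?_))
      exact Finset.mem_erase.2 ⟨fun h => (Finset.mem_erase.1 hw).1 (Subtype.ext h), w.2⟩
    · exact Ideal.subset_span (Finset.mem_image_of_mem _ (Finset.mem_erase.2 ⟨hzy, hz⟩))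
  have hmax : maximalIdeal (R ⧸ Ideal.span {x}) = Ideal.span
      (((s.erase y).image (Ideal.Quotient.mk (Ideal.span {x})) : Finset _) :
        Set (R ⧸ Ideal.span {x})) := by
    have hspan' : Ideal.span (s : Set R) = maximalIdeal R := hspan
    rw [maximalIdeal_quotient, ← hspan', Ideal.map_span]
    refine le_antisymm (Ideal.span_le.2 ?_) (Ideal.span_mono ?_)
    · rintro _ ⟨z, hz, rfl⟩
      exact hmem z hz
    · rw [Finset.coe_image]
      exact Set.image_mono (by simp)
  have hle := Submodule.spanFinrank_span_le_ncard_of_finite (R := R ⧸ Ideal.span {x})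
    ((s.erase y).image (Ideal.Quotient.mk (Ideal.span {x}))).finite_toSet
  rw [Set.ncard_coe_finset] at hle
  rw [hmax, ← hs, ← Finset.card_erase_add_one y.2]
  exact Nat.succ_le_succ (hle.trans Finset.card_image_le)

lemma ringKrullDim_le_quotient_succ {x : R} (hx : x ∈ maximalIdeal R) :
    ringKrullDim R ≤ ringKrullDim (R ⧸ Ideal.span {x}) + 1 := by
  have h := ringKrullDim_le_ringKrullDim_quotSMulTop_succ hx
  have : x • (⊤ : Ideal R) = Ideal.span {x} := by
    rw [← Submodule.ideal_span_singleton_smul, smul_eq_mul, Ideal.mul_top]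
  rwa [this] at h

variable (R) in
/-- The quotient of a module over itself by an element. -/
noncomputable def quotSMulTopSelfEquiv (x : R) : QuotSMulTop x R ≃ₗ[R] R ⧸ Ideal.span {x} :=
  Submodule.quotEquivOfEq _ _ (by
    rw [← Submodule.ideal_span_singleton_smul, smul_eq_mul, Ideal.mul_top])

lemma isDomain_and_exists_isWeaklyRegular (n : ℕ) (hR : IsRegularLocalRing R)
    (hn : ringKrullDim R = n) :
    IsDomain R ∧ ∃ rs : List R, rs.length = n ∧ (∀ r ∈ rs, r ∈ maximalIdeal R) ∧
      IsWeaklyRegular R rs ∧ Ideal.ofList rs = maximalIdeal R := by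
  induction n generalizing R with
  | zero =>
    have h0 := (isRegularLocalRing_iff R).1 hR
    rw [hn, Nat.cast_inj, Submodule.spanFinrank_eq_zero_iff_eq_bot
      (maximalIdeal R).fg_of_isNoetherianRing] at h0
    refine ⟨?_, [], rfl, by simp, .nil R R, by simp [h0]⟩
    exact (isField_iff_maximalIdeal_eq.2 h0).isDomain
  | succ n ih =>
    have hmin : ∀ q ∈ minimalPrimes R, ¬ maximalIdeal R ≤ q := by
      intro q hq hle
      have hqp : q.IsPrime := hq.isPrime
      have hq' : maximalIdeal R = q := le_antisymm hle (le_maximalIdeal hqp.ne_top)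
      have h0 : (maximalIdeal R).height = 0 := by
        rw [Ideal.height_eq_zero_iff, hq']
        exact hq
      have := maximalIdeal_height_eq_ringKrullDim (R := R)
      rw [h0, hn] at this
      have h2 : ((0 : ℕ) : WithBot ℕ∞) = ((n + 1 : ℕ) : WithBot ℕ∞) := this
      rw [Nat.cast_inj] at h2
      lia
    have hsq : ¬ maximalIdeal R ≤ maximalIdeal R ^ 2 := by
      intro hle
      have hbot : maximalIdeal R = ⊥ := by
        refine Submodule.eq_bot_of_le_smul_of_le_jacobson_bot (maximalIdeal R) _
          (maximalIdeal R).fg_of_isNoetherianRing ?_ (maximalIdeal_le_jacobson _)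
        rwa [smul_eq_mul, ← pow_two]
      obtain ⟨q, hq, -⟩ := Ideal.exists_minimalPrimes_le (bot_le : (⊥ : Ideal R) ≤ maximalIdeal R)
      exact hmin q hq (hbot ▸ bot_le)
    obtain ⟨x, hx, hx2, hxmin⟩ : ∃ x ∈ maximalIdeal R, x ∉ maximalIdeal R ^ 2 ∧
        ∀ q ∈ minimalPrimes R, x ∉ q := by
      by_contra! hcon
      -- Prime avoidance tolerates up to two ideals that are not prime; the square of the maximal
      -- ideal occupies both slots.
      obtain ⟨q, hq, hle⟩ := (Ideal.subset_union_prime_finite (R := R)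
        (s := insert (maximalIdeal R ^ 2) (minimalPrimes R))
        ((minimalPrimes.finite_of_isNoetherianRing R).insert _) (f := id)
        (maximalIdeal R ^ 2) (maximalIdeal R ^ 2) (fun q hq hne _ =>
          (hq.resolve_left hne).isPrime) (I := maximalIdeal R)).1 (by
        intro x hx
        by_cases hx2 : x ∈ maximalIdeal R ^ 2
        · exact Set.mem_biUnion (Set.mem_insert _ _) hx2
        · obtain ⟨q, hq, hxq⟩ := hcon x hx hx2
          exact Set.mem_biUnion (Set.mem_insert_of_mem _ hq) hxq)
      obtain rfl | hq := hq
      · exact hsq hle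
      · exact hmin q hq hle
    have hloc := isLocalRing_quotient_span_singleton hx
    have hsr := spanFinrank_maximalIdeal_quotient_succ_le hx hx2
    have hR' : ((maximalIdeal R).spanFinrank : WithBot ℕ∞) = (n + 1 : ℕ) :=
      ((isRegularLocalRing_iff R).1 hR).trans hn
    rw [Nat.cast_inj] at hR'
    have hdim1 := ringKrullDim_le_quotient_succ hx
    have hdim2 := ringKrullDim_le_spanFinrank_maximalIdeal (R ⧸ Ideal.span {x})
    have hdim3 : (n : WithBot ℕ∞) ≤ ringKrullDim (R ⧸ Ideal.span {x}) := by
      rw [hn, Nat.cast_add] at hdim1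
      exact (ENat.WithBot.add_le_add_natCast_right_iff (c := 1)).1 (by simpa using hdim1)
    have hdim4 : ((maximalIdeal (R ⧸ Ideal.span {x})).spanFinrank : WithBot ℕ∞) ≤ n :=
      Nat.cast_le.2 (by lia)
    have hreg' : IsRegularLocalRing (R ⧸ Ideal.span {x}) :=
      .of_spanFinrank_maximalIdeal_le _ (hdim4.trans hdim3)
    obtain ⟨hdom, rs, hl, hrs, hrsreg, hspan⟩ := ih hreg' (le_antisymm (hdim2.trans hdim4) hdim3)
    have hprime : (Ideal.span {x}).IsPrime := (Ideal.Quotient.isDomain_iff_prime _).1 hdom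
    obtain ⟨p, hp, hpx⟩ := Ideal.exists_minimalPrimes_le (bot_le : (⊥ : Ideal R) ≤ Ideal.span {x})
    have hpp : p.IsPrime := hp.isPrime
    -- An element of p is a multiple zx; since x ∉ p, z lies in p. Thus p = xp, and Nakayama gives p
    -- = 0.
    have hpbot : p = ⊥ := by
      refine Submodule.eq_bot_of_le_smul_of_le_jacobson_bot (maximalIdeal R) _
        p.fg_of_isNoetherianRing ?_ (maximalIdeal_le_jacobson _)
      intro y hy
      obtain ⟨z, rfl⟩ := Ideal.mem_span_singleton'.1 (hpx hy)
      rw [mul_comm]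
      exact Ideal.mul_mem_mul hx ((hpp.mem_or_mem hy).resolve_right (hxmin p hp))
    have hdomR : IsDomain R := by
      have := IsDomain.of_bot_isPrime R (hbp := hpbot ▸ hpp)
      exact this
    have hx0 : x ≠ 0 := fun h => hxmin p hp (h ▸ p.zero_mem)
    obtain ⟨ts, rfl⟩ : ∃ ts : List R, ts.map (algebraMap R (R ⧸ Ideal.span {x})) = rs :=
      ⟨rs.map (Function.surjInv Ideal.Quotient.mk_surjective), by
        rw [List.map_map]
        conv_rhs => rw [← List.map_id rs]
        refine List.map_congr_left fun r _ => Function.surjInv_eq Ideal.Quotient.mk_surjective r⟩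
    refine ⟨hdomR, x :: ts, by simpa using hl, ?_, ?_, ?_⟩
    · intro r hr
      obtain rfl | hr := List.mem_cons.1 hr
      · exact hx
      have h1 := hrs _ (List.mem_map_of_mem hr)
      by_contra hu
      exact h1 (IsUnit.map _ (by simpa using hu))
    · rw [isWeaklyRegular_cons_iff]
      refine ⟨isSMulRegular_iff_right_eq_zero_of_smul.2 fun y hy =>
        (mul_eq_zero.1 hy).resolve_left hx0, ?_⟩
      rw [(quotSMulTopSelfEquiv R x).isWeaklyRegular_congr]
      exact (isWeaklyRegular_map_algebraMap_iff _ _ ts).1 hrsreg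
    · rw [Ideal.ofList_cons]
      have h2 : (Ideal.ofList ts).map (Ideal.Quotient.mk (Ideal.span {x})) =
          (maximalIdeal R).map (Ideal.Quotient.mk (Ideal.span {x})) := by
        rw [← maximalIdeal_quotient, ← hspan, Ideal.map_ofList]
        rfl
      have h3 := congr(Ideal.comap (Ideal.Quotient.mk (Ideal.span {x})) $h2)
      rw [Ideal.comap_map_of_surjective' _ Ideal.Quotient.mk_surjective,
        Ideal.comap_map_of_surjective' _ Ideal.Quotient.mk_surjective, Ideal.mk_ker,
        sup_eq_left.2 ((Ideal.span_singleton_le_iff_mem _).2 hx)] at h3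
      rw [← h3, sup_comm]

lemma hasProjectiveDimensionLT_quotient_ofList {rs : List R} (hrs : IsWeaklyRegular R rs)
    (hm : ∀ r ∈ rs, r ∈ maximalIdeal R) :
    HasProjectiveDimensionLT (ModuleCat.of R (R ⧸ Ideal.ofList rs)) (rs.length + 1) := by
  have h := ModuleCat.projectiveDimension_quotient_eq_add_length_of_isWeaklyRegular
    (ModuleCat.of R R) rs hrs hm
  have : Projective (ModuleCat.of R R) := (IsProjective.iff_projective (R := R) R).1 inferInstance
  rw [ModuleCat.projectiveDimension_eq_zero_of_projective (ModuleCat.of R R), zero_add] at h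
  have h2 := (projectiveDimension_le_iff _ _).1 h.le
  have e : (R ⧸ Ideal.ofList rs • (⊤ : Ideal R)) ≃ₗ[R] R ⧸ Ideal.ofList rs :=
    Submodule.quotEquivOfEq _ _ (by simp)
  exact hasProjectiveDimensionLT_of_iso e.toModuleIso _

/-- Modules of maximal depth over regular local rings are free. -/
lemma free_of_isRegularLocalRing (hR : IsRegularLocalRing R) {n : ℕ} (hn : ringKrullDim R = n)
    {M : Type u} [AddCommGroup M] [Module R M] [Module.Finite R M]
    (hM : ExtVanishing R (ResidueField R) M n) : Module.Free R M := by
  obtain ⟨-, rs, rfl, hrs, hreg, hspan⟩ := isDomain_and_exists_isWeaklyRegular n hR hn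
  have hk := hasProjectiveDimensionLT_quotient_ofList hreg hrs
  have hk' : HasProjectiveDimensionLT (ModuleCat.of R (ResidueField R)) (rs.length + 1) :=
    hasProjectiveDimensionLT_of_iso ((Submodule.quotEquivOfEq _ _ hspan).trans
      (quotientMaximalIdealEquiv R)).toModuleIso _
  exact free_of_hasProjectiveDimensionLT_residueField hn.le hk'
    (extVanishing_iff_exists.2 ⟨rs, rfl, hrs, hreg⟩) hM

lemma height_add_ringKrullDim_quotient_le {S : Type*} [CommRing S] (p : Ideal S) [hp : p.IsPrime] :
    (p.height : WithBot ℕ∞) + ringKrullDim (S ⧸ p) ≤ ringKrullDim S := by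
  let P : PrimeSpectrum S := ⟨p, hp⟩
  have h1 : ringKrullDim (S ⧸ p) = Order.coheight P := by
    rw [ringKrullDim_quotient, Order.coheight_eq_krullDim_Ici]
    rfl
  have : Nonempty (PrimeSpectrum S) := ⟨P⟩
  rw [h1, PrimeSpectrum.height_eq_orderHeight P, ringKrullDim,
    Order.krullDim_eq_iSup_height_add_coheight_of_nonempty]
  have := le_iSup (fun a : PrimeSpectrum S => Order.height a + Order.coheight a) P
  exact_mod_cast this

/-- A module of maximal depth is free at the primes at which the ring is regular. -/
lemma free_localizedModule {d : ℕ} (hd : ringKrullDim R = d) (p : Ideal R) [p.IsPrime]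
    (hp : IsRegularLocalRing (Localization.AtPrime p))
    {M : Type u} [AddCommGroup M] [Module R M] [Module.Finite R M]
    (hM : ExtVanishing R (ResidueField R) M d) :
    Module.Free (Localization.AtPrime p) (LocalizedModule p.primeCompl M) := by
  have hle := height_add_ringKrullDim_quotient_le p
  have hnt : Nontrivial (R ⧸ p) := Ideal.Quotient.nontrivial_iff.2 (Ideal.IsPrime.ne_top ‹_›)
  obtain ⟨s, hs⟩ : ∃ s : ℕ, ringKrullDim (R ⧸ p) = s := by
    have h0 : ringKrullDim (R ⧸ p) ≤ d := hd ▸ ringKrullDim_quotient_le p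
    have h1 : 0 ≤ ringKrullDim (R ⧸ p) := ringKrullDim_nonneg_of_nontrivial
    generalize ringKrullDim (R ⧸ p) = a at h0 h1
    induction a with
    | bot => simp at h1
    | coe a =>
      induction a with
      | top =>
        have : (⊤ : ℕ∞) ≤ d := by exact_mod_cast h0
        simp at this
      | coe a => exact ⟨a, rfl⟩
  obtain ⟨h, hh⟩ : ∃ h : ℕ, p.height = h := ENat.ne_top_iff_exists.1
    (Ideal.height_ne_top (Ideal.IsPrime.ne_top ‹_›)) |>.imp fun _ => Eq.symm
  rw [hd, hs, hh] at hle
  have hle' : h + s ≤ d := by exact_mod_cast hle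
  -- Ischebeck gives vanishing of Ext^i(R/p, M) below d - dim R/p, which is at least the height of
  -- p. Rees then produces an M-regular sequence of that length inside p, and it survives
  -- localization.
  have hv := (hM.of_supportDim_le s (N := R ⧸ p)
    (by rw [Module.supportDim_quotient_eq_ringKrullDim, hs])).mono (by lia : h ≤ d - s)
  obtain ⟨rs, hl, hrs, hreg⟩ := hv.exists_isWeaklyRegular
  rw [Ideal.annihilator_quotient] at hrs
  have hreg' := hreg.of_isLocalizedModule (Localization.AtPrime p) p.primeCompl
    (LocalizedModule.mkLinearMap p.primeCompl M)
  refine free_of_isRegularLocalRing hp (n := h) ?_ (extVanishing_iff_exists.2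
    ⟨_, by simpa using hl, ?_, hreg'⟩)
  · rw [IsLocalization.AtPrime.ringKrullDim_eq_height p, hh]
    rfl
  · intro r hr
    obtain ⟨r, hr', rfl⟩ := List.mem_map.1 hr
    rw [← Localization.AtPrime.map_eq_maximalIdeal]
    exact Ideal.mem_map_of_mem _ (hrs r hr')

/-- If `M` is projective on the punctured spectrum, then the elements of a power of the maximal
ideal act on `M` through a given cover of `M`. -/
lemma exists_pow_le_factor {M F : Type u} [AddCommGroup M] [Module R M] [Module.Finite R M]
    [AddCommGroup F] [Module R F] {π : F →ₗ[R] M} (hπ : Function.Surjective π)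
    (hM : ∀ (p : Ideal R) [p.IsPrime], p ≠ maximalIdeal R →
      Module.Projective (Localization.AtPrime p) (LocalizedModule p.primeCompl M)) :
    ∃ n : ℕ, ∀ r ∈ maximalIdeal R ^ n, ∃ s : M →ₗ[R] F, π ∘ₗ s = r • LinearMap.id := by
  -- The ideal of those r for which r · id_M factors through π. It is enough that no prime other
  -- than the maximal ideal contains it.
  let I : Ideal R := (LinearMap.range (π.compRight R (M := M))).comap
    (LinearMap.toSpanSingleton R (M →ₗ[R] M) LinearMap.id)
  have hI (r : R) : r ∈ I ↔ ∃ s : M →ₗ[R] F, π ∘ₗ s = r • LinearMap.id := Iff.rfl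
  have hIp : ∀ (p : Ideal R) [p.IsPrime], p ≠ maximalIdeal R → ¬ I ≤ p := by
    intro p hp hpm hle
    have := hM p hpm
    have : Module.FinitePresentation R M := Module.finitePresentation_of_finite R M
    let πp := LocalizedModule.map p.primeCompl π
    have hπp : Function.Surjective πp := LocalizedModule.map_surjective _ π hπ
    -- The localized cover splits. The splitting is descended to a map g up to a denominator t, and
    -- the finitely many generators of M need only one further denominator c', so that c't lies in I
    -- but not in p.
    obtain ⟨σ, hσ⟩ := Module.projective_lifting_property πp LinearMap.id hπp
    obtain ⟨g, t, hg⟩ := Module.FinitePresentation.exists_lift_of_isLocalizedModule p.primeCompl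
      (LocalizedModule.mkLinearMap p.primeCompl F)
      ((σ.restrictScalars R) ∘ₗ LocalizedModule.mkLinearMap p.primeCompl M)
    have hker : ∀ m : M, LocalizedModule.mkLinearMap p.primeCompl M (π (g m)) =
        LocalizedModule.mkLinearMap p.primeCompl M (t • m) := by
      intro m
      have h1 : LocalizedModule.mkLinearMap p.primeCompl F (g m) =
          t • σ (LocalizedModule.mkLinearMap p.primeCompl M m) := congr($hg m)
      have h2 := congr(πp $h1)
      have h3 : πp (t • σ (LocalizedModule.mkLinearMap p.primeCompl M m)) =
          t • πp (σ (LocalizedModule.mkLinearMap p.primeCompl M m)) :=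
        (πp.restrictScalars R).map_smul (t : R) _
      have h6 : πp (σ (LocalizedModule.mkLinearMap p.primeCompl M m)) = _ := congr($hσ _)
      rw [h3, h6, LinearMap.id_apply] at h2
      have h4 : LocalizedModule.mkLinearMap p.primeCompl M (t • m) =
          t • LocalizedModule.mkLinearMap p.primeCompl M m :=
        (LocalizedModule.mkLinearMap p.primeCompl M).map_smul (t : R) m
      rw [h4, ← h2]
      simp [πp, LocalizedModule.map_mk]
    obtain ⟨n, v, hv⟩ := Module.Finite.exists_fin (R := R) (M := M)
    have hex (i : Fin n) := (IsLocalizedModule.eq_iff_exists p.primeCompl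
      (LocalizedModule.mkLinearMap p.primeCompl M)).1 (hker (v i))
    choose c hc using hex
    let c' : p.primeCompl := ∏ i, c i
    refine (c' * t).2 (hle ((hI _).2 ⟨(c' : R) • g, ?_⟩))
    refine LinearMap.ext_on_range hv fun i => ?_
    obtain ⟨b, hb⟩ : c i ∣ c' := Finset.dvd_prod_of_mem c (Finset.mem_univ i)
    have h5 : c' • π (g (v i)) = c' • (t • v i) := by
      rw [hb, mul_comm, mul_smul, hc i, mul_smul]
    simpa [mul_smul, Submonoid.smul_def] using h5
  have hrad : maximalIdeal R ≤ I.radical := by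
    rw [Ideal.radical_eq_sInf]
    refine le_sInf fun p hp => ?_
    have := hp.2
    by_contra hcon
    exact hIp p (fun h => hcon h.ge) hp.1
  obtain ⟨n, hn⟩ := Ideal.exists_pow_le_of_le_radical_of_fg hrad
    (maximalIdeal R).fg_of_isNoetherianRing
  exact ⟨n, fun r hr => (hI r).1 (hn hr)⟩

end Regular

/-! ### Serre's theorem on finite projective dimension of the residue field -/

section Serre

variable {R : Type u} [CommRing R]

lemma quotSMulTop_map_injective {M₁ M₂ M₃ : Type u} [AddCommGroup M₁] [Module R M₁]
    [AddCommGroup M₂] [Module R M₂] [AddCommGroup M₃] [Module R M₃]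
    {f : M₁ →ₗ[R] M₂} {g : M₂ →ₗ[R] M₃} (hf : Function.Injective f) (hfg : Function.Exact f g)
    {x : R} (hx : IsSMulRegular M₃ x) : Function.Injective (QuotSMulTop.map x f) := by
  have h := QuotSMulTop.map_first_exact_on_four_term_exact_of_isSMulRegular_last
    (f₁ := (0 : PUnit.{u + 1} →ₗ[R] M₁)) ((LinearMap.exact_zero_iff_injective _ f).2 hf) hfg hx
  rw [map_zero] at h
  exact (LinearMap.exact_zero_iff_injective _ _).1 h

/-- A free resolution of M stays exact modulo x: x is regular on M, and on each syzygy because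
syzygies sit inside free modules. -/
lemma hasProjectiveDimensionLT_quotSMulTop [IsLocalRing R] [IsNoetherianRing R] {x : R}
    (hx : IsSMulRegular R x)
    {M : Type u} [AddCommGroup M] [Module R M] [Module.Finite R M] (hxM : IsSMulRegular M x)
    {n : ℕ} (hM : HasProjectiveDimensionLT (ModuleCat.of R M) n) :
    HasProjectiveDimensionLT (ModuleCat.of (R ⧸ Ideal.span {x}) (QuotSMulTop x M)) n := by
  induction n generalizing M with
  | zero =>
    have := hasProjectiveDimensionLT_zero_iff.1 hM
    exact hasProjectiveDimensionLT_zero_iff.2 inferInstance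
  | succ n ih =>
    cases n with
    | zero =>
      have := hasProjectiveDimensionLT_one_iff.1 hM
      have : Module.Free R M := Module.free_of_flat_of_isLocalRing
      exact hasProjectiveDimensionLT_one_iff.2 inferInstance
    | succ n =>
      obtain ⟨m, f, hf⟩ := Module.Finite.exists_fin' R M
      have hK := (hasProjectiveDimensionLT_succ_succ_iff (Submodule.subtype_injective _)
          (kernel_exact f) hf).1 hM
      have hxF : IsSMulRegular (Fin m → R) x := .pi fun _ => hx
      have hxK : IsSMulRegular (LinearMap.ker f) x :=
        hxF.of_injective _ (Submodule.subtype_injective _)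
      let ι' := (QuotSMulTop.map x (LinearMap.ker f).subtype).extendScalarsOfSurjective
        (S := R ⧸ Ideal.span {x}) Ideal.Quotient.mk_surjective
      let f' := (QuotSMulTop.map x f).extendScalarsOfSurjective
        (S := R ⧸ Ideal.span {x}) Ideal.Quotient.mk_surjective
      refine (hasProjectiveDimensionLT_succ_succ_iff (f := ι') (g := f') ?_ ?_ ?_).2 (ih hxK hK)
      · exact quotSMulTop_map_injective (Submodule.subtype_injective _) (kernel_exact f) hxM
      · exact QuotSMulTop.map_exact x (kernel_exact f) hf
      · exact QuotSMulTop.map_surjective x hf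

variable [IsLocalRing R] [IsNoetherianRing R]

/-- The residue field is a direct summand of `𝔪 / x𝔪` if `x ∉ 𝔪²`. -/
lemma exists_retract_residueField {x : R} (hx : x ∈ maximalIdeal R)
    (hx2 : x ∉ maximalIdeal R ^ 2) :
    ∃ (i : ResidueField R →ₗ[R] QuotSMulTop x (maximalIdeal R))
      (p : QuotSMulTop x (maximalIdeal R) →ₗ[R] ResidueField R), p ∘ₗ i = LinearMap.id := by
  let x' : maximalIdeal R := ⟨x, hx⟩
  have hne : (maximalIdeal R).toCotangent x' ≠ 0 := by
    rwa [ne_eq, Ideal.toCotangent_eq_zero]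
  -- The class of x in the cotangent space is nonzero, so some functional sends it to 1. It induces
  -- the retraction onto k; the section sends 1 to the class of x.
  obtain ⟨φ, hφ⟩ : ∃ φ : Module.Dual (ResidueField R) (CotangentSpace R),
      φ ((maximalIdeal R).toCotangent x') = 1 := by
    by_contra! hcon
    refine hne ((Module.forall_dual_apply_eq_zero_iff (ResidueField R)
      (V := CotangentSpace R) _).1 fun φ => ?_)
    by_contra h0
    refine hcon ((φ ((maximalIdeal R).toCotangent x'))⁻¹ • φ) ?_
    rw [LinearMap.smul_apply, smul_eq_mul, inv_mul_cancel₀ h0]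
  let ψ : maximalIdeal R →ₗ[R] ResidueField R :=
    φ.restrictScalars R ∘ₗ (maximalIdeal R).toCotangent
  have hkill (r : R) (hr : r ∈ maximalIdeal R) (a : ResidueField R) : r • a = 0 := by
    rw [← annihilator_residueField R, Module.mem_annihilator] at hr
    exact hr a
  let p : QuotSMulTop x (maximalIdeal R) →ₗ[R] ResidueField R :=
    (x • (⊤ : Submodule R (maximalIdeal R))).liftQ ψ (by
      intro y hy
      obtain ⟨z, -, rfl⟩ := (Submodule.mem_smul_pointwise_iff_exists _ _ _).1 hy
      rw [LinearMap.mem_ker, map_smul, hkill x hx])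
  let i : (R ⧸ maximalIdeal R) →ₗ[R] QuotSMulTop x (maximalIdeal R) :=
    (maximalIdeal R).liftQ (LinearMap.toSpanSingleton R _ (Submodule.Quotient.mk x')) (by
      intro r hr
      rw [LinearMap.mem_ker, LinearMap.toSpanSingleton_apply, ← Submodule.Quotient.mk_smul,
        Submodule.Quotient.mk_eq_zero]
      have : r • x' = x • (⟨r, hr⟩ : maximalIdeal R) := Subtype.ext (mul_comm _ _)
      rw [this]
      exact Submodule.smul_mem_pointwise_smul _ _ _ trivial)
  refine ⟨i ∘ₗ (quotientMaximalIdealEquiv R).symm.toLinearMap, p, ?_⟩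
  have h1 : (p ∘ₗ i) (Submodule.Quotient.mk 1) = quotientMaximalIdealEquiv R
      (Submodule.Quotient.mk 1) := by
    have : i (Submodule.Quotient.mk 1) = Submodule.Quotient.mk x' := by
      change (1 : R) • (Submodule.Quotient.mk x' : QuotSMulTop x (maximalIdeal R)) = _
      exact one_smul _ _
    rw [LinearMap.comp_apply, this]
    exact hφ
  have h2 : p ∘ₗ i = (quotientMaximalIdealEquiv R).toLinearMap := by
    refine Submodule.linearMap_qext _ (LinearMap.ext_ring ?_)
    exact h1
  rw [← LinearMap.comp_assoc, h2]
  ext y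
  simp

variable (R) in
/-- The residue field of a quotient of a local ring. -/
noncomputable def residueFieldQuotientEquiv {x : R} [IsLocalRing (R ⧸ Ideal.span {x})] :
    ResidueField R ≃ₗ[R] ResidueField (R ⧸ Ideal.span {x}) :=
  (Submodule.quotEquivOfEq _ _ (by
    ext r
    have : IsLocalHom (Ideal.Quotient.mk (Ideal.span {x})) :=
      .of_surjective _ Ideal.Quotient.mk_surjective
    have h := maximalIdeal_comap (R := R) (Ideal.Quotient.mk (Ideal.span {x}))
    rw [← h, LinearMap.mem_ker, Ideal.mem_comap, Algebra.linearMap_apply]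
    exact (residue_eq_zero_iff _).symm) :
      (R ⧸ maximalIdeal R) ≃ₗ[R]
        R ⧸ LinearMap.ker (Algebra.linearMap R (ResidueField (R ⧸ Ideal.span {x})))).trans
  ((Algebra.linearMap R (ResidueField (R ⧸ Ideal.span {x}))).quotKerEquivOfSurjective
    (residue_surjective.comp Ideal.Quotient.mk_surjective))

/-- Serre's theorem: a noetherian local ring is regular if its residue field has finite projective
dimension. -/
theorem isRegularLocalRing_of_hasProjectiveDimensionLT {n : ℕ} (hn : ringKrullDim R = n) {m : ℕ}
    (hk : HasProjectiveDimensionLT (ModuleCat.of R (ResidueField R)) m) :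
    IsRegularLocalRing R := by
  induction n using Nat.strong_induction_on generalizing R m with
  | _ n ih =>
  by_cases hdepth : ExtVanishing R (ResidueField R) R 1
  swap
  -- In depth zero, finite projective dimension makes k free. Its annihilator, the maximal ideal, is
  -- then zero.
  · have hfree : Module.Free R (ResidueField R) := free_of_hasProjectiveDimensionLT (d := 0)
      (fun i hi => absurd hi i.not_lt_zero) hdepth (fun i hi => absurd hi i.not_lt_zero) hk
    have h0 := annihilator_residueField R
    have hnt : Nontrivial (ResidueField R) :=
      Ideal.Quotient.nontrivial_iff.2 (maximalIdeal.isMaximal R).ne_top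
    have hfaith : FaithfulSMul R (ResidueField R) :=
      Module.Free.instFaithfulSMulOfNontrivial R (ResidueField R)
    rw [Module.annihilator_eq_bot.2 hfaith] at h0
    refine .of_spanFinrank_maximalIdeal_le _ ?_
    rw [← h0, Submodule.spanFinrank_bot, hn]
    exact Nat.cast_le.2 (Nat.zero_le n)
  obtain ⟨r, hrm, hr⟩ := IsSMulRegular.subsingleton_linearMap_iff.1
    (extVanishing_one_iff.1 hdepth)
  rw [annihilator_residueField] at hrm
  have hass : ∀ q ∈ associatedPrimes R R, ¬ maximalIdeal R ≤ q := by
    intro q hq hle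
    have : r ∈ ⋃ p ∈ associatedPrimes R R, (p : Set R) := Set.mem_biUnion hq (hle hrm)
    rw [biUnion_associatedPrimes_eq_compl_regular R R] at this
    exact this hr
  have hsq : ¬ maximalIdeal R ≤ maximalIdeal R ^ 2 := by
    intro hle
    have hbot : maximalIdeal R = ⊥ := by
      refine Submodule.eq_bot_of_le_smul_of_le_jacobson_bot (maximalIdeal R) _
        (maximalIdeal R).fg_of_isNoetherianRing ?_ (maximalIdeal_le_jacobson _)
      rwa [smul_eq_mul, ← pow_two]
    rw [hbot, Ideal.mem_bot] at hrm
    rw [hrm, IsSMulRegular.zero_iff_subsingleton] at hr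
    exact not_subsingleton R hr
  obtain ⟨x, hx, hx2, hxreg⟩ : ∃ x ∈ maximalIdeal R, x ∉ maximalIdeal R ^ 2 ∧
      IsSMulRegular R x := by
    by_contra! hcon
    obtain ⟨q, hq, hle⟩ := (Ideal.subset_union_prime_finite (R := R)
      (s := insert (maximalIdeal R ^ 2) (associatedPrimes R R))
      ((associatedPrimes.finite R R).insert _) (f := id)
      (maximalIdeal R ^ 2) (maximalIdeal R ^ 2) (fun q hq hne _ =>
        (hq.resolve_left hne).isPrime) (I := maximalIdeal R)).1 (by
      intro x hx
      by_cases hx2 : x ∈ maximalIdeal R ^ 2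
      · exact Set.mem_biUnion (Set.mem_insert _ _) hx2
      · have hxz : x ∈ ⋃ p ∈ associatedPrimes R R, (p : Set R) := by
          rw [biUnion_associatedPrimes_eq_compl_regular R R]
          exact hcon x hx hx2
        obtain ⟨q, hq, hxq⟩ := Set.mem_iUnion₂.1 hxz
        exact Set.mem_biUnion (Set.mem_insert_of_mem _ hq) hxq)
    obtain rfl | hq := hq
    · exact hsq hle
    · exact hass q hq hle
  have hloc := isLocalRing_quotient_span_singleton hx
  have hdim := ringKrullDim_quotient_span_singleton_succ_eq_ringKrullDim hxreg hx
  obtain ⟨l, hl⟩ : ∃ l : ℕ, ringKrullDim (R ⧸ Ideal.span {x}) = l := by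
    rw [hn] at hdim
    have h1 : 0 ≤ ringKrullDim (R ⧸ Ideal.span {x}) := ringKrullDim_nonneg_of_nontrivial
    generalize ringKrullDim (R ⧸ Ideal.span {x}) = a at hdim h1
    induction a with
    | bot => simp at h1
    | coe a =>
      induction a with
      | top =>
        have : (⊤ : ℕ∞) + 1 = n := by exact_mod_cast hdim
        simp at this
      | coe a => exact ⟨a, rfl⟩
  have hln : l + 1 = n := by
    rw [hl, hn] at hdim
    exact_mod_cast hdim
  have hxm : IsSMulRegular (maximalIdeal R) x :=
    hxreg.of_injective (maximalIdeal R).subtype (Submodule.subtype_injective _)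
  have hpd : HasProjectiveDimensionLT (ModuleCat.of R (maximalIdeal R)) (m + 1) := by
    have hk' : HasProjectiveDimensionLT (ModuleCat.of R (R ⧸ maximalIdeal R)) (m + 2) :=
      hasProjectiveDimensionLT_of_ge (ModuleCat.of R (ResidueField R)) m (m + 2) (by lia)
    exact (hasProjectiveDimensionLT_succ_succ_iff (f := (maximalIdeal R).subtype)
      (g := (maximalIdeal R).mkQ) (Submodule.subtype_injective _)
      (LinearMap.exact_subtype_mkQ _) (Submodule.mkQ_surjective _)).1 hk'
  have hpd' := hasProjectiveDimensionLT_quotSMulTop hxreg hxm hpd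
  obtain ⟨i, p, hpi⟩ := exists_retract_residueField hx hx2
  let e := residueFieldQuotientEquiv R (x := x)
  let i' := (i ∘ₗ e.symm.toLinearMap).extendScalarsOfSurjective (S := R ⧸ Ideal.span {x})
    Ideal.Quotient.mk_surjective
  let p' := (e.toLinearMap ∘ₗ p).extendScalarsOfSurjective (S := R ⧸ Ideal.span {x})
    Ideal.Quotient.mk_surjective
  have hp'i' : p' ∘ₗ i' = LinearMap.id := by
    ext y
    have : p (i (e.symm y)) = e.symm y := congr($hpi _)
    change e (p (i (e.symm y))) = y
    rw [this, LinearEquiv.apply_symm_apply]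
  have hretract : Retract (ModuleCat.of (R ⧸ Ideal.span {x})
      (ResidueField (R ⧸ Ideal.span {x})))
      (ModuleCat.of (R ⧸ Ideal.span {x}) (QuotSMulTop x (maximalIdeal R))) :=
    ⟨ModuleCat.ofHom i', ModuleCat.ofHom p', by
      rw [← ModuleCat.ofHom_comp, hp'i', ModuleCat.ofHom_id]⟩
  have hreg := ih l (by lia) hl (hretract.hasProjectiveDimensionLT (m + 1))
  refine .of_spanFinrank_maximalIdeal_le _ ?_
  have h1 := (isRegularLocalRing_iff _).1 hreg
  rw [hl, Nat.cast_inj] at h1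
  have h2 := spanFinrank_maximalIdeal_le_succ hx
  rw [hn, Nat.cast_le]
  lia

end Serre

/-! ### Regular sequences in exact sequences and quotients by them -/

section RegularSequences

variable {R : Type u} [CommRing R]
variable {N M M₁ M₂ M₃ : Type u} [AddCommGroup N] [Module R N] [AddCommGroup M] [Module R M]
  [AddCommGroup M₁] [Module R M₁] [AddCommGroup M₂] [Module R M₂]
  [AddCommGroup M₃] [Module R M₃]

lemma isWeaklyRegular_of_retract {rs : List R} {i : M₁ →ₗ[R] M₂} {p : M₂ →ₗ[R] M₁}
    (h : p ∘ₗ i = LinearMap.id) (h₂ : IsWeaklyRegular M₂ rs) : IsWeaklyRegular M₁ rs := by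
  induction rs generalizing M₁ M₂ with
  | nil => exact .nil R M₁
  | cons x rs ih =>
    rw [isWeaklyRegular_cons_iff] at h₂ ⊢
    refine ⟨h₂.1.of_injective i ?_, ih (i := QuotSMulTop.map x i) (p := QuotSMulTop.map x p) ?_
      h₂.2⟩
    · exact Function.LeftInverse.injective (g := p) fun y => congr($h y)
    · rw [← QuotSMulTop.map_comp, h, QuotSMulTop.map_id]

lemma isSMulRegular_middle {f : M₁ →ₗ[R] M₂} {g : M₂ →ₗ[R] M₃}
    (hf : Function.Injective f) (hfg : Function.Exact f g) {x : R}
    (h₁ : IsSMulRegular M₁ x) (h₃ : IsSMulRegular M₃ x) : IsSMulRegular M₂ x := by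
  rw [isSMulRegular_iff_right_eq_zero_of_smul]
  intro y hy
  have h0 : g y = 0 := h₃.right_eq_zero_of_smul (by rw [← map_smul, hy, map_zero])
  obtain ⟨z, rfl⟩ := (hfg y).1 h0
  rw [← map_smul] at hy
  rw [h₁.right_eq_zero_of_smul (hf (hy.trans (map_zero f).symm)), map_zero]

lemma isWeaklyRegular_middle {rs : List R} {f : M₁ →ₗ[R] M₂} {g : M₂ →ₗ[R] M₃}
    (hf : Function.Injective f) (hfg : Function.Exact f g) (hg : Function.Surjective g)
    (h₁ : IsWeaklyRegular M₁ rs) (h₃ : IsWeaklyRegular M₃ rs) : IsWeaklyRegular M₂ rs := by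
  induction rs generalizing M₁ M₂ M₃ with
  | nil => exact .nil R M₂
  | cons x rs ih =>
    rw [isWeaklyRegular_cons_iff] at h₁ h₃ ⊢
    exact ⟨isSMulRegular_middle hf hfg h₁.1 h₃.1, ih (quotSMulTop_map_injective hf hfg h₃.1)
      (QuotSMulTop.map_exact x hfg hg) (QuotSMulTop.map_surjective x hg) h₁.2 h₃.2⟩

lemma isWeaklyRegular_left {rs : List R} {f : M₁ →ₗ[R] M₂} {g : M₂ →ₗ[R] M₃}
    (hf : Function.Injective f) (hfg : Function.Exact f g) (hg : Function.Surjective g)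
    (h₂ : IsWeaklyRegular M₂ rs) (h₃ : IsWeaklyRegular M₃ rs) : IsWeaklyRegular M₁ rs := by
  induction rs generalizing M₁ M₂ M₃ with
  | nil => exact .nil R M₁
  | cons x rs ih =>
    rw [isWeaklyRegular_cons_iff] at h₂ h₃ ⊢
    exact ⟨h₂.1.of_injective f hf, ih (quotSMulTop_map_injective hf hfg h₃.1)
      (QuotSMulTop.map_exact x hfg hg) (QuotSMulTop.map_surjective x hg) h₂.2 h₃.2⟩

lemma isWeaklyRegular_prod {rs : List R} (h₁ : IsWeaklyRegular M₁ rs)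
    (h₂ : IsWeaklyRegular M₂ rs) : IsWeaklyRegular (M₁ × M₂) rs :=
  isWeaklyRegular_middle (f := LinearMap.inl R M₁ M₂) (g := LinearMap.snd R M₁ M₂)
    LinearMap.inl_injective (LinearMap.exact_iff.2 (LinearMap.ker_snd R M₁ M₂))
    LinearMap.snd_surjective h₁ h₂

lemma isWeaklyRegular_pi {rs : List R} (h : IsWeaklyRegular R rs) (m : ℕ) :
    IsWeaklyRegular (Fin m → R) rs :=
  ((TensorProduct.rid R (Fin m → R)).isWeaklyRegular_congr rs).1
    h.isWeaklyRegular_lTensor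

variable (M) in
/-- The quotient of a module by a sequence of elements. -/
abbrev QuotList (rs : List R) : Type u := M ⧸ (Ideal.ofList rs • (⊤ : Submodule R M))

/-- The functoriality of the quotient by a sequence of elements. -/
abbrev quotListMap (rs : List R) (f : M₁ →ₗ[R] M₂) : QuotList M₁ rs →ₗ[R] QuotList M₂ rs :=
  Submodule.mapQ _ _ f (Submodule.smul_top_le_comap_smul_top _ f)

lemma quotListMap_surjective (rs : List R) {f : M₁ →ₗ[R] M₂} (hf : Function.Surjective f) :
    Function.Surjective (quotListMap rs f) := by
  intro y
  obtain ⟨y, rfl⟩ := Submodule.mkQ_surjective _ y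
  obtain ⟨y, rfl⟩ := hf y
  exact ⟨Submodule.mkQ _ y, rfl⟩

lemma quotListMap_exact (rs : List R) {f : M₁ →ₗ[R] M₂} {g : M₂ →ₗ[R] M₃}
    (hfg : Function.Exact f g) (hg : Function.Surjective g) :
    Function.Exact (quotListMap rs f) (quotListMap rs g) := by
  rw [hfg.exact_mapQ_iff, Submodule.map_smul'', Submodule.map_top]
  rw [LinearMap.range_eq_top.2 hg, top_inf_eq]

lemma ExtVanishing.quotList {n : ℕ} {rs : List R} (hrs : IsWeaklyRegular M rs)
    (h : ExtVanishing R N M (n + rs.length)) : ExtVanishing R N (QuotList M rs) n := by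
  induction rs generalizing M with
  | nil =>
    refine h.congr (.refl R N) (Submodule.quotEquivOfEqBot _ ?_).symm
    rw [Ideal.ofList_nil, Submodule.bot_smul]
  | cons x rs ih =>
    rw [isWeaklyRegular_cons_iff] at hrs
    exact (ih hrs.2 (h.quotSMulTop hrs.1)).congr (.refl R N)
      (Submodule.quotOfListConsSMulTopEquivQuotSMulTopInner M x rs).symm

end RegularSequences

/-! ### Closures and tiers: building maximal Cohen–Macaulay modules -/

section Closure

variable {R : Type u} [CommRing R]

/-- The closure of a subcategory is closed under isomorphisms. -/
lemma Closure.of_equiv {S : ObjectProperty (FGModuleCat.{u} R)} {X Y : FGModuleCat.{u} R}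
    (e : X ≃ₗ[R] Y) (hX : Closure S X) : Closure S Y :=
  .summand (X' := FGModuleCat.of R PUnit.{u + 1})
    (e.trans (LinearEquiv.prodUnique (R := R) (M := Y) (M₂ := PUnit.{u + 1})).symm) hX

lemma Closure.mono {S T : ObjectProperty (FGModuleCat.{u} R)} (h : ∀ X, S X → Closure T X)
    {X : FGModuleCat.{u} R} (hX : Closure S X) : Closure T X := by
  induction hX with
  | of hX => exact h _ hX
  | zero hX => exact .zero hX
  | extension f g hf hfg hg _ _ h₁ h₃ => exact .extension f g hf hfg hg h₁ h₃
  | summand e _ h => exact .summand e h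

lemma tierNat_eq_closure (S : ObjectProperty (FGModuleCat.{u} R)) (n : ℕ) :
    ∃ T, tierNat S n = Closure T := by
  cases n with
  | zero => exact ⟨_, rfl⟩
  | succ n => exact ⟨_, rfl⟩

lemma tier_eq_closure (S : ObjectProperty (FGModuleCat.{u} R)) (n : ℤ) :
    ∃ T, tier S n = Closure T := by
  cases n with
  | ofNat n => exact tierNat_eq_closure S n
  | negSucc n => exact ⟨_, rfl⟩

lemma tierNat_mono {S : ObjectProperty (FGModuleCat.{u} R)} {m n : ℕ} (hmn : m ≤ n)
    {X : FGModuleCat.{u} R} (hX : tierNat S m X) : tierNat S n X := by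
  induction hmn with
  | refl => exact hX
  | step _ ih => exact Closure.of (Or.inl ih)

lemma closure_le_tierNat {S : ObjectProperty (FGModuleCat.{u} R)} (n : ℕ)
    {X : FGModuleCat.{u} R} (hX : Closure S X) : tierNat S n X :=
  tierNat_mono (Nat.zero_le n) (hX.mono fun _ h => .of (Or.inl h))

lemma closure_le_tier {S : ObjectProperty (FGModuleCat.{u} R)} (n : ℤ)
    {X : FGModuleCat.{u} R} (hX : Closure S X) : tier S n X := by
  cases n with
  | ofNat n => exact closure_le_tierNat n hX
  | negSucc n => exact hX

lemma tier_mono {S : ObjectProperty (FGModuleCat.{u} R)} {m n : ℤ} (hmn : m ≤ n)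
    {X : FGModuleCat.{u} R} (hX : tier S m X) : tier S n X := by
  cases m with
  | negSucc m => exact closure_le_tier n hX
  | ofNat m =>
    obtain ⟨n, rfl⟩ := Int.eq_ofNat_of_zero_le ((Int.natCast_nonneg m).trans hmn)
    exact tierNat_mono (Int.ofNat_le.1 hmn) hX

lemma tierNat_of_projective (S : ObjectProperty (FGModuleCat.{u} R)) (X : FGModuleCat.{u} R)
    [Module.Projective R X] : tierNat S 0 X := by
  refine .of (Or.inr ⟨FGModuleCat.of R PUnit.{u + 1}, X, 0, LinearMap.id,
    .zero (inferInstanceAs (Subsingleton PUnit)), inferInstance, ?_, ?_, Function.surjective_id⟩)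
  · exact fun _ _ _ => Subsingleton.elim (α := PUnit) _ _
  · exact (LinearMap.exact_zero_iff_injective _ _).2 Function.injective_id

/-- This holds for every S: projectives are cosyzygies of zero, hence in tier 0, and each step back
along a free resolution is one cosyzygy. -/
lemma tierNat_of_hasProjectiveDimensionLT [IsNoetherianRing R]
    (S : ObjectProperty (FGModuleCat.{u} R)) (n : ℕ) (M : Type u) [AddCommGroup M] [Module R M]
    [Module.Finite R M] (h : HasProjectiveDimensionLT (ModuleCat.of R M) (n + 1)) :
    tierNat S n (FGModuleCat.of R M) := by
  induction n generalizing M with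
  | zero =>
    have : Module.Projective R (FGModuleCat.of R M) := hasProjectiveDimensionLT_one_iff.1 h
    exact tierNat_of_projective S _
  | succ n ih =>
    obtain ⟨m, f, hf⟩ := Module.Finite.exists_fin' R M
    have hK := ih (LinearMap.ker f) ((hasProjectiveDimensionLT_succ_succ_iff
      (Submodule.subtype_injective _) (kernel_exact f) hf).1 h)
    exact .of (Or.inr ⟨FGModuleCat.of R (LinearMap.ker f), FGModuleCat.of R (Fin m → R),
      (LinearMap.ker f).subtype, f, hK, inferInstanceAs (Module.Projective R (Fin m → R)),
      Submodule.subtype_injective _, kernel_exact f, hf⟩)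

lemma closure_pi {S : ObjectProperty (FGModuleCat.{u} R)} {M : Type u} [AddCommGroup M]
    [Module R M] [Module.Finite R M] (h : Closure S (FGModuleCat.of R M)) (m : ℕ) :
    Closure S (FGModuleCat.of R (Fin m → M)) := by
  induction m with
  | zero => exact .zero (inferInstanceAs (Subsingleton (Fin 0 → M)))
  | succ m ih =>
    have h2 : Closure S (FGModuleCat.of R (M × (Fin m → M))) :=
      .extension (X := FGModuleCat.of R M) (Z := FGModuleCat.of R (Fin m → M))
        (LinearMap.inl R M (Fin m → M)) (LinearMap.snd R M (Fin m → M)) LinearMap.inl_injective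
        (LinearMap.exact_iff.2 (LinearMap.ker_snd R M (Fin m → M))) LinearMap.snd_surjective h ih
    exact h2.of_equiv (X := FGModuleCat.of R (M × (Fin m → M)))
      (Y := FGModuleCat.of R (Fin (m + 1) → M)) (Fin.consLinearEquiv R fun _ => M)

/-- The inductive step: if an element `x` acts on a cover `F → M` through the kernel `K`, then `M`
can be built from `F` and `K / xK`. -/
lemma closure_of_factor {S : ObjectProperty (FGModuleCat.{u} R)} {K F M : Type u}
    [AddCommGroup K] [Module R K] [Module.Finite R K] [AddCommGroup F] [Module R F]
    [Module.Finite R F] [AddCommGroup M] [Module R M] [Module.Finite R M]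
    {ι : K →ₗ[R] F} {π : F →ₗ[R] M} (hιπ : Function.Exact ι π) (hπ : Function.Surjective π)
    {x : R} {φ : F →ₗ[R] K} (hφ : φ ∘ₗ ι = x • LinearMap.id) (hx : IsSMulRegular K x)
    (hF : Closure S (FGModuleCat.of R F)) (hK : Closure S (FGModuleCat.of R (QuotSMulTop x K))) :
    Closure S (FGModuleCat.of R M) := by
  have hφ' (k : K) : φ (ι k) = x • k := congr($hφ k)
  -- The map (φ, π) is injective since φ restricts to the regular element x on K. Its cokernel is a
  -- quotient of K by exactly xK, so K × M is an extension of K/xK by F.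
  let ψ : F →ₗ[R] K × M := φ.prod π
  have hψ : Function.Injective ψ := by
    rw [← LinearMap.ker_eq_bot, LinearMap.ker_eq_bot']
    intro y hy
    obtain ⟨h1, h2⟩ := Prod.ext_iff.1 hy
    obtain ⟨k, rfl⟩ := (hιπ y).1 h2
    have h3 : x • k = 0 := (hφ' k).symm.trans h1
    rw [hx.right_eq_zero_of_smul h3, map_zero]
  let q : K →ₗ[R] (K × M) ⧸ LinearMap.range ψ := Submodule.mkQ _ ∘ₗ LinearMap.inl R K M
  have hq : Function.Surjective q := by
    intro z
    obtain ⟨⟨k, y⟩, rfl⟩ := Submodule.mkQ_surjective _ z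
    obtain ⟨f, rfl⟩ := hπ y
    refine ⟨k - φ f, (Submodule.Quotient.eq _).2 ⟨-f, ?_⟩⟩
    ext <;> simp [ψ]
  have hker : LinearMap.ker q = x • (⊤ : Submodule R K) := by
    ext k
    rw [Submodule.mem_smul_pointwise_iff_exists]
    simp only [q, LinearMap.mem_ker, LinearMap.comp_apply, Submodule.mkQ_apply,
      Submodule.Quotient.mk_eq_zero, LinearMap.mem_range]
    constructor
    · rintro ⟨f, hf⟩
      obtain ⟨h1, h2⟩ := Prod.ext_iff.1 hf
      obtain ⟨k', rfl⟩ := (hιπ f).1 h2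
      exact ⟨k', trivial, (hφ' k').symm.trans h1⟩
    · rintro ⟨k', -, rfl⟩
      exact ⟨ι k', Prod.ext (hφ' k') (hιπ.apply_apply_eq_zero k')⟩
  have e : QuotSMulTop x K ≃ₗ[R] (K × M) ⧸ LinearMap.range ψ :=
    (Submodule.quotEquivOfEq _ _ hker.symm).trans (q.quotKerEquivOfSurjective hq)
  have hZ : Closure S (FGModuleCat.of R ((K × M) ⧸ LinearMap.range ψ)) :=
    hK.of_equiv (X := FGModuleCat.of R (QuotSMulTop x K)) e
  have hprod : Closure S (FGModuleCat.of R (K × M)) :=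
    .extension (X := FGModuleCat.of R F) (Y := FGModuleCat.of R (K × M)) ψ
      (LinearMap.range ψ).mkQ hψ (LinearMap.exact_map_mkQ_range ψ) (Submodule.mkQ_surjective _)
      hF hZ
  exact .summand (X := FGModuleCat.of R M) (X' := FGModuleCat.of R K)
    (LinearEquiv.prodComm R K M) hprod

variable [IsLocalRing R] [IsNoetherianRing R]

/-- Modules killed by a power of the maximal ideal are iterated extensions of the residue field. -/
lemma closure_residueField_of_pow (n : ℕ) (M : Type u) [AddCommGroup M] [Module R M]
    [hM : Module.Finite R M] (h : ∀ r ∈ maximalIdeal R ^ n, ∀ y : M, r • y = 0) :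
    Closure (residueFieldSubcat R) (FGModuleCat.of R M) := by
  induction hM using IsNoetherianRing.induction_on_isQuotientEquivQuotientPrime with
  | subsingleton N => exact .zero (inferInstanceAs (Subsingleton N))
  | quotient N q e =>
    have hle : maximalIdeal R ≤ q.asIdeal := by
      refine q.2.le_of_pow_le (n := n) fun r hr => ?_
      have h1 := congr(e $(h r hr (e.symm (Ideal.Quotient.mk _ 1))))
      rw [map_smul, LinearEquiv.apply_symm_apply, map_zero, ← Ideal.Quotient.mkₐ_eq_mk R,
        ← map_smul, Ideal.Quotient.mkₐ_eq_mk, Ideal.Quotient.eq_zero_iff_mem, smul_eq_mul,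
        mul_one] at h1
      exact h1
    have hq : q.asIdeal = maximalIdeal R := le_antisymm (le_maximalIdeal q.2.ne_top) hle
    exact .of ⟨e.trans ((Submodule.quotEquivOfEq _ _ hq).trans (quotientMaximalIdealEquiv R))⟩
  | exact N₁ N₂ N₃ f g hf hg hfg h₁ h₃ =>
    refine .extension (X := FGModuleCat.of R N₁) (Y := FGModuleCat.of R N₂)
      (Z := FGModuleCat.of R N₃) f g hf hfg hg (h₁ fun r hr y => hf ?_) (h₃ fun r hr y => ?_)
    · rw [map_smul, h r hr, map_zero]
    · obtain ⟨y, rfl⟩ := hg y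
      rw [← map_smul, h r hr, map_zero]

/-- A regular sequence of length dim R cuts the dimension down to 0, so the maximal ideal is the
only prime containing it. -/
lemma exists_pow_le_ofList {rs : List R} (hm : ∀ r ∈ rs, r ∈ maximalIdeal R)
    (hrs : IsWeaklyRegular R rs) (hd : ringKrullDim R = rs.length) :
    ∃ n, maximalIdeal R ^ n ≤ Ideal.ofList rs := by
  have hreg : IsRegular R rs := .of_isWeaklyRegular_of_mem_maximalIdeal R hm hrs
  have hdim := ringKrullDim_add_length_eq_ringKrullDim_of_isRegular rs hreg
  have hdim0 : ringKrullDim (R ⧸ Ideal.ofList rs) ≤ (0 : ℕ) := by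
    rw [hd] at hdim
    exact (ENat.WithBot.add_le_add_natCast_right_iff (c := rs.length)).1 (by simpa using hdim.le)
  have : Ring.KrullDimLE 0 (R ⧸ Ideal.ofList rs) := Ring.krullDimLE_iff.2 hdim0
  refine Ideal.exists_pow_le_of_le_radical_of_fg ?_ (maximalIdeal R).fg_of_isNoetherianRing
  rw [Ideal.radical_eq_sInf]
  refine le_sInf fun p hp => ?_
  have := hp.2
  have : (p.map (Ideal.Quotient.mk (Ideal.ofList rs))).IsPrime :=
    Ideal.isPrime_map_quotientMk_of_isPrime hp.1
  have hmax : (p.map (Ideal.Quotient.mk (Ideal.ofList rs))).IsMaximal :=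
    Ideal.IsPrime.isMaximal' this
  have hmax' := Ideal.comap_isMaximal_of_surjective (Ideal.Quotient.mk (Ideal.ofList rs))
    Ideal.Quotient.mk_surjective (K := p.map (Ideal.Quotient.mk (Ideal.ofList rs)))
  rw [Ideal.comap_map_of_surjective' _ Ideal.Quotient.mk_surjective, Ideal.mk_ker,
    sup_eq_left.2 hp.1] at hmax'
  exact (eq_maximalIdeal hmax').ge

/-- If the quotients of `R` by short regular sequences and the modules of finite length are in a
closed subcategory, then so are the maximal Cohen–Macaulay modules that are projective on the
punctured spectrum. -/
lemma closure_quotList {S : ObjectProperty (FGModuleCat.{u} R)} {d : ℕ} (hd : ringKrullDim R = d)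
    (hR : ExtVanishing R (ResidueField R) R d)
    (hproj : ∀ (M : Type u) [AddCommGroup M] [Module R M] [Module.Finite R M],
      ExtVanishing R (ResidueField R) M d → ∀ (p : Ideal R) [p.IsPrime], p ≠ maximalIdeal R →
        Module.Projective (Localization.AtPrime p) (LocalizedModule p.primeCompl M))
    (hS : ∀ rs : List R, rs.length < d → (∀ r ∈ rs, r ∈ maximalIdeal R) → IsWeaklyRegular R rs →
      Closure S (FGModuleCat.of R (R ⧸ Ideal.ofList rs)))
    (hS' : ∀ X, Closure (residueFieldSubcat R) X → Closure S X)
    (j : ℕ) (rs : List R) (hj : rs.length + j = d) (hm : ∀ r ∈ rs, r ∈ maximalIdeal R)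
    (hrs : IsWeaklyRegular R rs) (M : Type u) [AddCommGroup M] [Module R M] [Module.Finite R M]
    (hM : ExtVanishing R (ResidueField R) M d) (hrsM : IsWeaklyRegular M rs) :
    Closure S (FGModuleCat.of R (QuotList M rs)) := by
  induction j generalizing rs M with
  | zero =>
    obtain ⟨n, hn⟩ := exists_pow_le_ofList hm hrs (by rw [hd, ← hj, add_zero])
    refine hS' _ (closure_residueField_of_pow n _ fun r hr y => ?_)
    obtain ⟨y, rfl⟩ := Submodule.mkQ_surjective _ y
    rw [← map_smul]
    exact (Submodule.Quotient.mk_eq_zero _).2 (Submodule.smul_mem_smul (hn hr) trivial)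
  | succ j ih =>
    obtain ⟨m, π, hπ⟩ := Module.Finite.exists_fin' R M
    have hK : ExtVanishing R (ResidueField R) (LinearMap.ker π) d :=
      .left (Submodule.subtype_injective _) (kernel_exact π) hπ (hR.pi m) (hM.mono (by lia))
    have hrsK : IsWeaklyRegular (LinearMap.ker π) rs := isWeaklyRegular_left
      (Submodule.subtype_injective _) (kernel_exact π) hπ (isWeaklyRegular_pi hrs m) hrsM
    obtain ⟨n, hn⟩ := exists_pow_le_factor hπ (hproj M hM)
    -- Working with the product yields a single element y that is regular modulo `rs` on both R and
    -- the kernel.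
    have hrsW : IsWeaklyRegular (R × LinearMap.ker π) rs := isWeaklyRegular_prod hrs hrsK
    have hW : ExtVanishing R (ResidueField R) (QuotList (R × LinearMap.ker π) rs) 1 :=
      .quotList hrsW ((hR.prod hK).mono (by lia))
    obtain ⟨y, hy, hyreg⟩ := IsSMulRegular.subsingleton_linearMap_iff.1
      (extVanishing_one_iff.1 hW)
    rw [annihilator_residueField] at hy
    -- The n-th power already acts through the cover; the extra factor keeps x in the maximal ideal
    -- when n = 0.
    let x := y ^ (n + 1)
    have hxm : x ∈ maximalIdeal R := Ideal.pow_mem_of_mem _ hy _ n.succ_pos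
    have hxreg : IsSMulRegular (QuotList (R × LinearMap.ker π) rs) x := hyreg.pow (n + 1)
    obtain ⟨s, hs⟩ := hn x (Ideal.pow_le_pow_right n.le_succ (Ideal.pow_mem_pow hy _))
    have hxrsm : ∀ r ∈ x :: rs, r ∈ maximalIdeal R := by
      intro r hr
      rcases List.mem_cons.1 hr with h | h
      exacts [h ▸ hxm, hm r h]
    have hreg : IsWeaklyRegular (R × LinearMap.ker π) (rs ++ [x]) :=
      (isWeaklyRegular_append_iff _ rs [x]).2
        ⟨hrsW, (isWeaklyRegular_singleton_iff _ x).2 hxreg⟩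
    have hregK : IsWeaklyRegular (LinearMap.ker π) (rs ++ [x]) :=
      isWeaklyRegular_of_retract (LinearMap.snd_comp_inr R R (LinearMap.ker π)) hreg
    have hregR : IsWeaklyRegular R (rs ++ [x]) :=
      isWeaklyRegular_of_retract (LinearMap.fst_comp_inl R R (LinearMap.ker π)) hreg
    -- Regularity of x modulo `rs` puts x last, while the induction puts it first; over a local ring
    -- regular sequences of elements of the maximal ideal may be permuted.
    have hperm : (rs ++ [x]).Perm (x :: rs) := List.perm_append_singleton x rs
    have hmem : ∀ r ∈ rs ++ [x], r ∈ maximalIdeal R := fun r hr => hxrsm r (hperm.mem_iff.1 hr)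
    have hind := ih (x :: rs) (by simp; lia) hxrsm
      (isWeaklyRegular_of_perm_of_subset_maximalIdeal hregR hperm hmem) (LinearMap.ker π) hK
      (isWeaklyRegular_of_perm_of_subset_maximalIdeal hregK hperm hmem)
    -- Since πs = x, the map x - sπ lands in the kernel of π, and on that kernel it is
    -- multiplication by x.
    let φ : (Fin m → R) →ₗ[R] LinearMap.ker π :=
      (x • LinearMap.id - s ∘ₗ π).codRestrict _ fun f => by
        have h1 : π (s (π f)) = x • π f := congr($hs (π f))
        simp [LinearMap.mem_ker, h1]
    have hφ : φ ∘ₗ (LinearMap.ker π).subtype = x • LinearMap.id := by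
      ext k : 2
      have : π k = 0 := k.2
      simp [φ, this]
    refine closure_of_factor (ι := quotListMap rs (LinearMap.ker π).subtype)
      (π := quotListMap rs π) (x := x) (φ := quotListMap rs φ)
      (quotListMap_exact rs (kernel_exact π) hπ) (quotListMap_surjective rs hπ) ?_ ?_ ?_ ?_
    · rw [← Submodule.mapQ_comp]
      refine Submodule.linearMap_qext _ ?_
      ext k
      change Submodule.Quotient.mk ((φ ∘ₗ (LinearMap.ker π).subtype) k) = _
      rw [hφ]
      rfl
    · exact (isWeaklyRegular_singleton_iff _ x).1
        ((isWeaklyRegular_append_iff _ rs [x]).1 hregK).2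
    · have e : (Fin m → R ⧸ Ideal.ofList rs) ≃ₗ[R] QuotList (Fin m → R) rs :=
        (TensorProduct.piScalarRight R R (R ⧸ Ideal.ofList rs) (Fin m)).symm.trans
          (TensorProduct.quotTensorEquivQuotSMul (Fin m → R) (Ideal.ofList rs))
      exact (closure_pi (hS rs (by lia) hm hrs) m).of_equiv
        (X := FGModuleCat.of R (Fin m → R ⧸ Ideal.ofList rs))
        (Y := FGModuleCat.of R (QuotList (Fin m → R) rs)) e
    · exact hind.of_equiv (X := FGModuleCat.of R (QuotList (LinearMap.ker π) (x :: rs)))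
        (Y := FGModuleCat.of R (QuotSMulTop x (QuotList (LinearMap.ker π) rs)))
        (Submodule.quotOfListConsSMulTopEquivQuotSMulTopOuter (LinearMap.ker π) x rs)

end Closure

/-! ### Torsion with respect to powers of an ideal -/

section PowTorsion

variable {R : Type u} [CommRing R] (I : Ideal R)
variable (M : Type u) {N : Type u} [AddCommGroup M] [Module R M] [AddCommGroup N] [Module R N]

/-- The submodule of elements killed by a power of the ideal `I`. -/
def powTorsion : Submodule R M := ⨆ n : ℕ, Submodule.torsionBySet R M (I ^ n : Ideal R)

lemma monotone_torsionBySet_pow :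
    Monotone fun n : ℕ => Submodule.torsionBySet R M (I ^ n : Ideal R) :=
  fun _ _ hmn => Submodule.torsionBySet_le_torsionBySet_of_subset (Ideal.pow_le_pow_right hmn)

variable {I M}

lemma mem_powTorsion {x : M} : x ∈ powTorsion I M ↔ ∃ n : ℕ, ∀ u ∈ I ^ n, u • x = 0 := by
  rw [powTorsion, Submodule.mem_iSup_of_directed _ (monotone_torsionBySet_pow I M).directed_le]
  simp [Submodule.mem_torsionBySet_iff]

variable (I M) in
lemma exists_smul_powTorsion_eq_zero [IsNoetherian R M] :
    ∃ n : ℕ, ∀ u ∈ I ^ n, ∀ x ∈ powTorsion I M, u • x = 0 := by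
  obtain ⟨n, hn⟩ := monotone_stabilizes_iff_noetherian.2 ‹_›
    ⟨_, monotone_torsionBySet_pow I M⟩
  refine ⟨n, fun u hu x hx => ?_⟩
  obtain ⟨m, hm⟩ := mem_powTorsion.1 hx
  have h1 : x ∈ Submodule.torsionBySet R M (I ^ (max n m) : Ideal R) :=
    (Submodule.mem_torsionBySet_iff _ _).2 fun a =>
      hm a (Ideal.pow_le_pow_right (le_max_right n m) a.2)
  have h2 : x ∈ Submodule.torsionBySet R M (I ^ n : Ideal R) :=
    (hn _ (le_max_left n m)).ge h1
  exact (Submodule.mem_torsionBySet_iff _ _).1 h2 ⟨u, hu⟩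

lemma powTorsion_le_comap (f : M →ₗ[R] N) : powTorsion I M ≤ (powTorsion I N).comap f := by
  intro x hx
  obtain ⟨n, hn⟩ := mem_powTorsion.1 hx
  exact mem_powTorsion.2 ⟨n, fun u hu => by rw [← map_smul, hn u hu, map_zero]⟩

lemma mem_powTorsion_of_injective {f : M →ₗ[R] N} (hf : Function.Injective f) {x : M}
    (hx : f x ∈ powTorsion I N) : x ∈ powTorsion I M := by
  obtain ⟨n, hn⟩ := mem_powTorsion.1 hx
  exact mem_powTorsion.2 ⟨n, fun u hu => hf (by rw [map_smul, hn u hu, map_zero])⟩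

variable (I) in
/-- The map induced on the quotients by the torsion submodules. -/
abbrev powTorsionMap (f : M →ₗ[R] N) : M ⧸ powTorsion I M →ₗ[R] N ⧸ powTorsion I N :=
  Submodule.mapQ _ _ f (powTorsion_le_comap f)

lemma powTorsion_eq_bot_of_isSMulRegular {r : R} (hr : r ∈ I) (h : IsSMulRegular M r) :
    powTorsion I M = ⊥ := by
  refine (Submodule.eq_bot_iff _).2 fun x hx => ?_
  obtain ⟨n, hn⟩ := mem_powTorsion.1 hx
  exact (h.pow n).right_eq_zero_of_smul (hn _ (Ideal.pow_mem_pow hr n))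

/-- An element that becomes torsion modulo a submodule `X` can be corrected by an element of `X` to
a torsion element, if `X` modulo torsion has depth at least two. -/
lemma exists_sub_mem_powTorsion {X Y Z : Type u} [AddCommGroup X] [Module R X] [AddCommGroup Y]
    [Module R Y] [AddCommGroup Z] [Module R Z] [IsNoetherian R Y] {f : X →ₗ[R] Y} {g : Y →ₗ[R] Z}
    (hf : Function.Injective f) (hfg : Function.Exact f g)
    (hX : ∀ n : ℕ, ∃ r ∈ I ^ n, ∃ s ∈ I ^ n, IsSMulRegular (X ⧸ powTorsion I X) r ∧
      IsSMulRegular (QuotSMulTop r (X ⧸ powTorsion I X)) s)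
    {y : Y} (hy : g y ∈ powTorsion I Z) : ∃ x, y - f x ∈ powTorsion I Y := by
  obtain ⟨a, ha⟩ := mem_powTorsion.1 hy
  obtain ⟨r, hr, s, hs, hreg, hreg'⟩ := hX a
  obtain ⟨x₁, hx₁⟩ := (hfg (r • y)).1 (by rw [map_smul, ha r hr])
  obtain ⟨x₂, hx₂⟩ := (hfg (s • y)).1 (by rw [map_smul, ha s hs])
  have h12 : s • x₁ = r • x₂ := hf (by rw [map_smul, map_smul, hx₁, hx₂, smul_comm])
  -- Formally y is x₁/r = x₂/s. As s x₁ = r x₂ and s is regular modulo r, x₁ is divisible by r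
  -- modulo torsion; the quotient x is the correction sought.
  have hmem : Submodule.Quotient.mk (p := powTorsion I X) x₁ ∈
      r • (⊤ : Submodule R (X ⧸ powTorsion I X)) := by
    refine (Submodule.Quotient.mk_eq_zero _).1 (hreg'.right_eq_zero_of_smul ?_)
    rw [← Submodule.Quotient.mk_smul, ← Submodule.Quotient.mk_smul, h12,
      Submodule.Quotient.mk_smul, Submodule.Quotient.mk_eq_zero]
    exact Submodule.smul_mem_pointwise_smul _ _ _ trivial
  obtain ⟨z, -, hz⟩ := (Submodule.mem_smul_pointwise_iff_exists _ _ _).1 hmem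
  obtain ⟨x, rfl⟩ := Submodule.mkQ_surjective _ z
  have hγ : x₁ - r • x ∈ powTorsion I X := (Submodule.Quotient.eq _).1 hz.symm
  have hry : r • (y - f x) = f (x₁ - r • x) := by rw [smul_sub, map_sub, map_smul, hx₁]
  -- Each u(y - f x) comes from some w in X with rw torsion, so w is torsion because r is regular
  -- modulo torsion. One power of I kills all torsion of Y, by noetherianity.
  have key (u : R) (hu : u ∈ I ^ a) : u • (y - f x) ∈ powTorsion I Y := by
    obtain ⟨w, hw⟩ := (hfg (u • (y - f x))).1 (by
      rw [map_smul, map_sub, hfg.apply_apply_eq_zero, sub_zero, ha u hu])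
    have hrw : r • w = u • (x₁ - r • x) := hf (by
      rw [map_smul, hw, smul_comm, hry, map_smul])
    have hw' : w ∈ powTorsion I X := by
      refine (Submodule.Quotient.mk_eq_zero _).1 (hreg.right_eq_zero_of_smul ?_)
      rw [← Submodule.Quotient.mk_smul, hrw, Submodule.Quotient.mk_eq_zero]
      exact Submodule.smul_mem _ u hγ
    rw [← hw]
    exact powTorsion_le_comap f hw'
  obtain ⟨n, hn⟩ := exists_smul_powTorsion_eq_zero I Y
  refine ⟨x, mem_powTorsion.2 ⟨n + a, fun u hu => ?_⟩⟩
  rw [pow_add] at hu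
  refine Submodule.mul_induction_on hu (fun v hv w hw => ?_) fun v w hv hw => ?_
  · rw [mul_smul, hn v hv _ (key w hw)]
  · rw [add_smul, hv, hw, add_zero]

lemma powTorsionMap_injective {f : M →ₗ[R] N} (hf : Function.Injective f) :
    Function.Injective (powTorsionMap I f) := by
  rw [← LinearMap.ker_eq_bot, LinearMap.ker_eq_bot']
  intro x hx
  obtain ⟨x, rfl⟩ := Submodule.mkQ_surjective _ x
  exact (Submodule.Quotient.mk_eq_zero _).2
    (mem_powTorsion_of_injective hf ((Submodule.Quotient.mk_eq_zero _).1 hx))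

end PowTorsion

/-! ### Projective dimension modulo torsion along the tiers of k -/

section TorsionDimension

variable {R : Type u} [CommRing R] [IsLocalRing R]
variable {M : Type u} [AddCommGroup M] [Module R M]

lemma ExtVanishing.exists_mem_pow_isSMulRegular [IsNoetherianRing R] [Module.Finite R M]
    (h : ExtVanishing R (ResidueField R) M 1) (n : ℕ) :
    ∃ r ∈ maximalIdeal R ^ n, IsSMulRegular M r := by
  obtain ⟨r, hr, hreg⟩ := IsSMulRegular.subsingleton_linearMap_iff.1 (extVanishing_one_iff.1 h)
  rw [annihilator_residueField] at hr
  exact ⟨r ^ n, Ideal.pow_mem_pow hr n, hreg.pow n⟩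

lemma ExtVanishing.powTorsion_eq_bot [IsNoetherianRing R] [Module.Finite R M]
    (h : ExtVanishing R (ResidueField R) M 1) : powTorsion (maximalIdeal R) M = ⊥ := by
  obtain ⟨r, hr, hreg⟩ := h.exists_mem_pow_isSMulRegular 1
  exact powTorsion_eq_bot_of_isSMulRegular ((pow_one (maximalIdeal R)) ▸ hr) hreg

variable (R) in
/-- The modules whose quotient by the elements of finite length has projective dimension less than
`n`. -/
def HasTorsionFreeDimensionLT (n : ℕ) : ObjectProperty (FGModuleCat.{u} R) :=
  fun X => HasProjectiveDimensionLT (ModuleCat.of R (X ⧸ powTorsion (maximalIdeal R) X)) n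

lemma HasTorsionFreeDimensionLT.mono {m n : ℕ} (hmn : m ≤ n) {X : FGModuleCat.{u} R}
    (h : HasTorsionFreeDimensionLT R m X) : HasTorsionFreeDimensionLT R n X :=
  have : HasProjectiveDimensionLT
    (ModuleCat.of R (X ⧸ powTorsion (maximalIdeal R) X)) m := h
  hasProjectiveDimensionLT_of_ge _ m n hmn

lemma hasTorsionFreeDimensionLT_of_powTorsion_eq_top (n : ℕ) {X : FGModuleCat.{u} R}
    (h : powTorsion (maximalIdeal R) X = ⊤) : HasTorsionFreeDimensionLT R n X :=
  .mono (Nat.zero_le n) (hasProjectiveDimensionLT_zero_iff.2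
    (Submodule.Quotient.subsingleton_iff.2 h))

lemma hasTorsionFreeDimensionLT_iff_of_powTorsion_eq_bot {n : ℕ} {X : FGModuleCat.{u} R}
    (h : powTorsion (maximalIdeal R) X = ⊥) :
    HasTorsionFreeDimensionLT R n X ↔ HasProjectiveDimensionLT (ModuleCat.of R X) n :=
  let e := (Submodule.quotEquivOfEqBot _ h).toModuleIso
  ⟨fun h => have : HasProjectiveDimensionLT _ n := h; hasProjectiveDimensionLT_of_iso e n,
    fun _ => hasProjectiveDimensionLT_of_iso e.symm n⟩

lemma hasTorsionFreeDimensionLT_of_residueFieldSubcat (n : ℕ) {X : FGModuleCat.{u} R}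
    (hX : residueFieldSubcat R X) : HasTorsionFreeDimensionLT R n X := by
  obtain ⟨e⟩ := hX
  refine hasTorsionFreeDimensionLT_of_powTorsion_eq_top n (eq_top_iff.2 fun x _ => ?_)
  refine mem_powTorsion.2 ⟨1, fun u hu => e.injective ?_⟩
  rw [pow_one, ← annihilator_residueField] at hu
  rw [map_smul, Module.mem_annihilator.1 hu, map_zero]

variable [IsNoetherianRing R] {d n : ℕ}

lemma HasTorsionFreeDimensionLT.closure (hR : ExtVanishing R (ResidueField R) R d)
    (hn : n < d) {S : ObjectProperty (FGModuleCat.{u} R)}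
    (hS : ∀ X, S X → HasTorsionFreeDimensionLT R n X) {X : FGModuleCat.{u} R} (hX : Closure S X) :
    HasTorsionFreeDimensionLT R n X := by
  induction hX with
  | of hX => exact hS _ hX
  | zero hX =>
    exact hasTorsionFreeDimensionLT_of_powTorsion_eq_top n (Subsingleton.elim _ _)
  | @extension X Y Z f g hf hfg hg _ _ h₁ h₃ =>
    -- The depth is at least d + 1 - n, and n < d is exactly what makes this at least 2, as lifting
    -- torsion from Z to Y requires.
    have hX2 : ExtVanishing R (ResidueField R) (X ⧸ powTorsion (maximalIdeal R) X) 2 :=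
      (ExtVanishing.of_hasProjectiveDimensionLT hR h₁).mono (by lia)
    have hex : Function.Exact (powTorsionMap (maximalIdeal R) f)
        (powTorsionMap (maximalIdeal R) g) := by
      intro y
      obtain ⟨y, rfl⟩ := Submodule.mkQ_surjective _ y
      constructor
      · intro hy
        obtain ⟨x, hx⟩ := exists_sub_mem_powTorsion hf hfg (fun a => by
          obtain ⟨r, hr, hreg⟩ := (hX2.mono one_le_two).exists_mem_pow_isSMulRegular a
          obtain ⟨s, hs, hreg'⟩ :=
            (ExtVanishing.quotSMulTop hreg hX2).exists_mem_pow_isSMulRegular a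
          exact ⟨r, hr, s, hs, hreg, hreg'⟩) ((Submodule.Quotient.mk_eq_zero _).1 hy)
        exact ⟨Submodule.Quotient.mk x, ((Submodule.Quotient.eq _).2 hx).symm⟩
      · rintro ⟨x, hx⟩
        obtain ⟨x, rfl⟩ := Submodule.mkQ_surjective _ x
        rw [← hx]
        refine (Submodule.Quotient.mk_eq_zero _).2 ?_
        rw [hfg.apply_apply_eq_zero]
        exact zero_mem _
    have hsurj : Function.Surjective (powTorsionMap (maximalIdeal R) g) := by
      intro z
      obtain ⟨z, rfl⟩ := Submodule.mkQ_surjective _ z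
      obtain ⟨y, rfl⟩ := hg z
      exact ⟨Submodule.Quotient.mk y, rfl⟩
    exact (exactShortComplex_shortExact (powTorsionMap_injective hf) hex
      hsurj).hasProjectiveDimensionLT_X₂ n h₁ h₃
  | @summand X X' Y e _ h =>
    have : HasProjectiveDimensionLT
      (ModuleCat.of R (Y ⧸ powTorsion (maximalIdeal R) Y)) n := h
    refine Retract.hasProjectiveDimensionLT
      (Y := ModuleCat.of R (Y ⧸ powTorsion (maximalIdeal R) Y))
      ⟨ModuleCat.ofHom (powTorsionMap (maximalIdeal R) (e.symm.toLinearMap ∘ₗ LinearMap.inl R X X')),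
        ModuleCat.ofHom (powTorsionMap (maximalIdeal R) (LinearMap.fst R X X' ∘ₗ e.toLinearMap)),
        ?_⟩ n
    rw [← ModuleCat.ofHom_comp, ← Submodule.mapQ_comp]
    ext x
    simp

/-- N is torsion-free as a submodule of a projective, so its own projective dimension is bounded.
The resulting bound for X gives X positive depth, so X is torsion-free too. -/
lemma HasTorsionFreeDimensionLT.cosyzygy (hR : ExtVanishing R (ResidueField R) R d)
    (hn : n + 1 < d) {S : ObjectProperty (FGModuleCat.{u} R)}
    (hS : ∀ X, S X → HasTorsionFreeDimensionLT R n X) {X : FGModuleCat.{u} R}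
    (hX : Cosyzygy S X) : HasTorsionFreeDimensionLT R (n + 1) X := by
  obtain ⟨N, P, f, g, hN, hP, hf, hfg, hg⟩ := hX
  have hP1 : ExtVanishing R (ResidueField R) P 1 := (hR.mono (by lia)).of_projective
  have hN1 : HasProjectiveDimensionLT (ModuleCat.of R N) n :=
    (hasTorsionFreeDimensionLT_iff_of_powTorsion_eq_bot
      (ExtVanishing.of_injective_one hf hP1).powTorsion_eq_bot).1 (hS N hN)
  have hP2 : HasProjectiveDimensionLT (ModuleCat.of R P) 1 := hasProjectiveDimensionLT_one_iff.2 hP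
  have hX1 : HasProjectiveDimensionLT (ModuleCat.of R X) (n + 1) :=
    (exactShortComplex_shortExact hf hfg hg).hasProjectiveDimensionLT_X₃ n hN1
      (hasProjectiveDimensionLT_of_ge _ 1 (n + 1) (by lia))
  exact (hasTorsionFreeDimensionLT_iff_of_powTorsion_eq_bot
    ((ExtVanishing.of_hasProjectiveDimensionLT hR hX1).mono (by lia)).powTorsion_eq_bot).2 hX1

lemma HasTorsionFreeDimensionLT.of_tierNat (hR : ExtVanishing R (ResidueField R) R d) (n : ℕ)
    (hn : n + 1 < d) {X : FGModuleCat.{u} R} (hX : tierNat (residueFieldSubcat R) n X) :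
    HasTorsionFreeDimensionLT R (n + 1) X := by
  induction n generalizing X with
  | zero =>
    refine .closure hR hn (fun Y hY => ?_) hX
    obtain hY | hY := hY
    · exact hasTorsionFreeDimensionLT_of_residueFieldSubcat 1 hY
    · exact .cosyzygy hR hn (fun _ => .closure hR (by lia) fun _ =>
        hasTorsionFreeDimensionLT_of_residueFieldSubcat 0) hY
  | succ n ih =>
    refine .closure hR hn (fun Y hY => ?_) hX
    obtain hY | hY := hY
    · exact (ih (by lia) hY).mono n.succ.le_succ
    · exact .cosyzygy hR hn (fun _ => ih (by lia)) hY

lemma free_of_tier (hR : ExtVanishing R (ResidueField R) R d)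
    (hR' : ¬ ExtVanishing R (ResidueField R) R (d + 1)) (hd : 1 ≤ d) {X : FGModuleCat.{u} R}
    (hX : ExtVanishing R (ResidueField R) X d)
    (h : tier (residueFieldSubcat R) ((d : ℤ) - 2) X) : Module.Free R X := by
  have h' : HasTorsionFreeDimensionLT R (d - 1) X := by
    -- For d = 1 the index d - 2 is -1, so the tier is the plain closure of k, with bound 0.
    obtain rfl | ⟨n, rfl⟩ : d = 1 ∨ ∃ n, d = n + 2 := by
      obtain rfl | hd := hd.eq_or_lt
      exacts [.inl rfl, .inr ⟨d - 2, by lia⟩]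
    · exact .closure hR (by lia) (fun _ => hasTorsionFreeDimensionLT_of_residueFieldSubcat 0) h
    · have hn : ((n + 2 : ℕ) : ℤ) - 2 = Int.ofNat n := by simp
      rw [hn] at h
      exact .of_tierNat hR n (by lia) h
  exact free_of_hasProjectiveDimensionLT hR hR' hX
    ((hasTorsionFreeDimensionLT_iff_of_powTorsion_eq_bot (hX.mono hd).powTorsion_eq_bot).1 h')

end TorsionDimension

/-! ### Isolated singularities and the two bounds -/

section Main

variable {R : Type u} [CommRing R] [IsLocalRing R]

/-- Over a ring with an isolated singularity, `S(R)` consists of the modules isomorphic to `k`. -/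
lemma HasIsolatedSingularity.singularSubcat_eq (h : HasIsolatedSingularity R) :
    singularSubcat R = residueFieldSubcat R := by
  ext X
  constructor
  · rintro ⟨p, hp, ⟨e⟩⟩
    have hpm : p.asIdeal = maximalIdeal R := by
      by_contra hne
      exact hp (h.2 p hne)
    exact ⟨e.trans ((Submodule.quotEquivOfEq _ _ hpm).trans (quotientMaximalIdealEquiv R))⟩
  · rintro ⟨e⟩
    refine ⟨⟨maximalIdeal R, inferInstance⟩, fun hreg => h.1 ?_,
      ⟨e.trans (quotientMaximalIdealEquiv R).symm⟩⟩
    have : IsRegularLocalRing (Localization.AtPrime (maximalIdeal R)) := hreg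
    let e : R ≃ₐ[R] Localization.AtPrime (maximalIdeal R) :=
      IsLocalization.atUnits R (maximalIdeal R).primeCompl fun x => by simpa using! fun a => a
    exact IsRegularLocalRing.of_ringEquiv e.toRingEquiv.symm

variable [IsNoetherianRing R]

/-- Syzygies of high order have high depth. -/
lemma exists_syzygy {d : ℕ} (hR : ExtVanishing R (ResidueField R) R d) (M : Type u)
    [AddCommGroup M] [Module R M] [Module.Finite R M] (n : ℕ) (hn : n ≤ d) :
    ∃ K : FGModuleCat.{u} R, ExtVanishing R (ResidueField R) K n ∧
      ∀ j : ℕ, HasProjectiveDimensionLT (ModuleCat.of R K) (j + 1) →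
        HasProjectiveDimensionLT (ModuleCat.of R M) (j + n + 1) := by
  induction n with
  | zero => exact ⟨FGModuleCat.of R M, fun i hi => absurd hi i.not_lt_zero, fun j hj => hj⟩
  | succ n ih =>
    obtain ⟨K, hK, hKM⟩ := ih (by lia)
    obtain ⟨m, f, hf⟩ := Module.Finite.exists_fin' R K
    refine ⟨FGModuleCat.of R (LinearMap.ker f), .left (Submodule.subtype_injective _)
      (kernel_exact f) hf ((hR.mono hn).pi m) hK, fun j hj => ?_⟩
    have := hKM (j + 1) ((hasProjectiveDimensionLT_succ_succ_iff
      (Submodule.subtype_injective _) (kernel_exact f) hf).2 hj)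
    rwa [add_assoc j, add_comm 1 n] at this

/-- If all modules of maximal depth are free, then the ring is regular. -/
lemma isRegularLocalRing_of_forall_free {d : ℕ} (hd : ringKrullDim R = d)
    (hR : IsMaximalCohenMacaulay R R)
    (h : ∀ X : FGModuleCat.{u} R, maximalCohenMacaulay R X → Module.Free R X) :
    IsRegularLocalRing R := by
  obtain ⟨-, hR, hR'⟩ := (isMaximalCohenMacaulay_iff hd).1 hR
  obtain ⟨K, hK, hKk⟩ := exists_syzygy hR (ResidueField R) d le_rfl
  -- The syzygy K may be zero, which is not maximal Cohen–Macaulay; adding R makes the depth exactly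
  -- d.
  have hfree : Module.Free R (K × R) := h (FGModuleCat.of R (K × R))
    ((isMaximalCohenMacaulay_iff hd).2 ⟨inferInstance, hK.prod hR, fun h =>
      hR' (h.of_retract (LinearMap.snd_comp_inr R K R))⟩)
  have hproj : Module.Projective R K :=
    .of_split (LinearMap.inl R K R) (LinearMap.fst R K R) (LinearMap.fst_comp_inl R K R)
  exact isRegularLocalRing_of_hasProjectiveDimensionLT hd
    (hKk 0 (hasProjectiveDimensionLT_one_iff.2 hproj))

/-- Over a local ring of maximal depth that is regular on the punctured spectrum, the maximal
Cohen–Macaulay modules are in the tier of index `d - 1` of the residue field. -/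
lemma maximalCohenMacaulay_le_tier {d : ℕ} (hd : ringKrullDim R = d)
    (hR : ExtVanishing R (ResidueField R) R d)
    (hreg : ∀ p : PrimeSpectrum R, p.asIdeal ≠ maximalIdeal R →
      IsRegularLocalRing (Localization.AtPrime p.asIdeal)) :
    maximalCohenMacaulay R ≤ tier (residueFieldSubcat R) ((d : ℤ) - 1) := by
  intro X hX
  obtain ⟨-, hX, -⟩ := (isMaximalCohenMacaulay_iff hd).1 hX
  -- The index d - 1 may be -1, so the tier is treated uniformly as a closure.
  obtain ⟨T, hT⟩ := tier_eq_closure (residueFieldSubcat R) ((d : ℤ) - 1)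
  have key := closure_quotList (S := T) hd hR
    (fun M _ _ _ hM p hp hpm => by
      have := free_localizedModule hd p (hreg ⟨p, hp⟩ hpm) hM
      infer_instance)
    (fun rs hlt hm hrs => by
      rw [← hT]
      refine tier_mono (m := Int.ofNat rs.length) ?_
        (tierNat_of_hasProjectiveDimensionLT _ _ _ (hasProjectiveDimensionLT_quotient_ofList hrs hm))
      change (rs.length : ℤ) ≤ d - 1
      lia)
    (fun X hX => hT ▸ closure_le_tier _ hX) d [] (by simp) (by simp) (.nil R R) X hX (.nil R X)
  rw [hT]
  refine key.of_equiv (X := FGModuleCat.of R (QuotList X [])) (Submodule.quotEquivOfEqBot _ ?_)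
  rw [Ideal.ofList_nil, Submodule.bot_smul]

end Main

end ModTier

theorem mainTheorem6 {R : Type u} [CommRing R] [IsLocalRing R]
    (hR : ModTier.IsCohenMacaulayLocalRing R) (d : ℕ) (hd : ringKrullDim R = d) :
    (1 ≤ d → ∀ M : FGModuleCat.{u} R, ModTier.maximalCohenMacaulay R M →
      ModTier.tier (ModTier.residueFieldSubcat R) ((d : ℤ) - 2) M → Module.Free R M) ∧
    (ModTier.HasIsolatedSingularity R →
      IsLeast {n : ℤ | -1 ≤ n ∧
        ModTier.maximalCohenMacaulay R ≤ ModTier.tier (ModTier.singularSubcat R) n}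
        ((d : ℤ) - 1)) := by
  obtain ⟨hnoeth, hCM⟩ := hR
  obtain ⟨-, hE, hE'⟩ := (ModTier.isMaximalCohenMacaulay_iff hd).1 hCM
  have hfree : 1 ≤ d → ∀ M : FGModuleCat.{u} R, ModTier.maximalCohenMacaulay R M →
      ModTier.tier (ModTier.residueFieldSubcat R) ((d : ℤ) - 2) M → Module.Free R M :=
    fun hd1 M hM => ModTier.free_of_tier hE hE' hd1
      ((ModTier.isMaximalCohenMacaulay_iff hd).1 hM).2.1
  refine ⟨hfree, fun hsing => ?_⟩
  rw [hsing.singularSubcat_eq]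
  refine ⟨⟨by lia, ModTier.maximalCohenMacaulay_le_tier hd hE hsing.2⟩, fun n hn => ?_⟩
  obtain ⟨hn1, hn2⟩ := hn
  by_contra! hlt
  -- From -1 ≤ n < d - 1 it follows that d ≥ 1 and n ≤ d - 2, so all maximal Cohen–Macaulay modules
  -- would be free.
  exact hsing.1 (ModTier.isRegularLocalRing_of_forall_free hd hCM fun X hX =>
    hfree (by lia) X hX (ModTier.tier_mono (by lia) (hn2 X hX)))
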